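/- Let $\Omega$ be a set and let $\mathrm{Sym}(\Omega)$ carry the permutation topology (the topology of pointwise convergence, in which the pointwise stabilisers of finite subsets of $\Omega$ form a neighbourhood basis of the identity); subgroups carry the subspace topology. Let $G\le\mathrm{Sym}(\Omega)$ be a primitive permutation group that is closed in $\mathrm{Sym}(\Omega)$ and subdegree-finite, i.e. all orbits of the point stabilisers $G_\alpha$ $(\alpha\in\Omega)$ are finite. Suppose that $G$ has more than one end, i.e. some connected finite union of orbital graphs $(\Omega,\{\alpha,\beta\}^G)$ of $G$ has more than one end (the number of ends does not depend on the choice of such a union). Then $G$ is almost topologically simple: there is a nonabelian, closed normal subgroup $B$ of $G$ that is topologically simple (that is, $B$ is nontrivial and has no closed normal subgroups other than $1$ and $B$) and satisfies $B\le G\le \mathrm{Aut}\,B$, meaning that the conjugation action $G\to\mathrm{Aut}\,B$ is injective. More precisely, $G$ has a unique minimal closed normal subgroup (a minimal element among its nontrivial closed normal subgroups), and $B$ can be taken to be this subgroup. -/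

import Mathlib

/-- The permutation topology on `Sym(Ω)`: the topology of pointwise convergence, where `Ω` is
discrete. Subgroups carry the subspace topology, which is their own permutation topology. -/
instance permutationTopology (Ω : Type*) : TopologicalSpace (Equiv.Perm Ω) :=
  TopologicalSpace.induced (fun g : Equiv.Perm Ω => (g : Ω → Ω))
    (@Pi.topologicalSpace Ω (fun _ => Ω) (fun _ => ⊥))

/-- A neighbourhood basis of the identity consists of the pointwise stabilisers of finite sets. -/
theorem permutationTopology_hasBasis_nhds_one (Ω : Type*) :
    (nhds (1 : Equiv.Perm Ω)).HasBasis (fun Φ : Set Ω => Φ.Finite)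
      (fun Φ => {g : Equiv.Perm Ω | ∀ x ∈ Φ, g x = x}) := by
  let _ : TopologicalSpace Ω := ⊥
  have _ : DiscreteTopology Ω := ⟨rfl⟩
  have h : nhds (1 : Equiv.Perm Ω) =
      Filter.comap (fun g : Equiv.Perm Ω => (g : Ω → Ω)) (nhds (fun x => x)) :=
    nhds_induced _ _
  rw [h, nhds_pi]
  simp only [nhds_discrete]
  constructor
  intro s
  rw [Filter.mem_comap]
  constructor
  · rintro ⟨t, ht, hts⟩
    rw [Filter.mem_pi] at ht
    obtain ⟨I, hI, u, hu, hut⟩ := ht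
    refine ⟨I, hI, fun g hg => hts (hut fun i hi => ?_)⟩
    have h1 : g i = i := hg i hi
    show g i ∈ u i
    rw [h1]
    exact hu i
  · rintro ⟨Φ, hΦ, hs⟩
    refine ⟨Set.pi Φ (fun x => {x}), Filter.mem_pi.2 ⟨Φ, hΦ, fun x => {x}, ?_, subset_rfl⟩, ?_⟩
    · intro i
      exact rfl
    · intro g hg
      exact hs fun x hx => hg x hx

/-- All orbits of all point stabilisers are finite. -/
def IsSubdegreeFinite {Ω : Type*} (G : Subgroup (Equiv.Perm Ω)) : Prop :=
  ∀ α β : Ω, (MulAction.orbit (MulAction.stabilizer G α) β).Finite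

/-- The orbital graph of `G` with vertex set `Ω` and edge set the orbit `{α, β}^G`
(it has no edges if `α = β`). -/
def orbitalGraph {Ω : Type*} (G : Subgroup (Equiv.Perm Ω)) (α β : Ω) : SimpleGraph Ω where
  Adj x y := x ≠ y ∧ ∃ g : G, s(x, y) = s(g • α, g • β)
  symm := ⟨fun _ _ h => ⟨h.1.symm, by simpa only [Sym2.eq_swap] using h.2⟩⟩
  loopless := ⟨fun _ h => h.1 rfl⟩

/-- `G` has more than one end: some connected finite union of orbital graphs of `G` has more than
one end. (For transitive, subdegree-finite `G`, all such graphs are locally finite and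
quasi-isometric, so that they all have the same number of ends.) -/
def HasMoreThanOneEnd {Ω : Type*} (G : Subgroup (Equiv.Perm Ω)) : Prop :=
  ∃ S : Finset (Ω × Ω),
    (⨆ p ∈ S, orbitalGraph G p.1 p.2).Connected ∧
    (⨆ p ∈ S, orbitalGraph G p.1 p.2).end.Nontrivial

/-- A nontrivial topological group whose only closed normal subgroups are the trivial group and
the whole group. -/
def IsTopologicallySimple (H : Type*) [Group H] [TopologicalSpace H] : Prop :=
  Nontrivial H ∧ ∀ N : Subgroup H, N.Normal → IsClosed (N : Set H) → N = ⊥ ∨ N = ⊤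

/-- `B` is a nonabelian, topologically simple, closed normal subgroup of `G`, and `B ≤ G ≤ Aut B`
in the usual sense: the action of `G` on `B` by conjugation, `G → Aut B`, is injective. -/
structure IsAlmostTopologicallySimpleOver {G : Type*} [Group G] [TopologicalSpace G]
    (B : Subgroup G) : Prop where
  normal : B.Normal
  isClosed : IsClosed (B : Set G)
  nonabelian : ∃ a b : B, a * b ≠ b * a
  topologicallySimple : IsTopologicallySimple B
  conj_injective : Function.Injective (MulAut.conjNormal : G →* MulAut B)

/-- `G` is almost topologically simple. -/
def IsAlmostTopologicallySimple (G : Type*) [Group G] [TopologicalSpace G] : Prop :=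
  ∃ B : Subgroup G, IsAlmostTopologicallySimpleOver B

/-- `B` is a minimal closed normal subgroup of `G`, i.e. minimal among the nontrivial closed
normal subgroups. -/
def IsMinimalClosedNormal {G : Type*} [Group G] [TopologicalSpace G] (B : Subgroup G) : Prop :=
  Minimal (fun N : Subgroup G => N ≠ ⊥ ∧ N.Normal ∧ IsClosed (N : Set G)) B

/-! Let Γ be a connected finite union of orbital graphs with more than one end. Subdegree-finiteness
makes Γ locally finite, and with closedness it makes the sets `{g | g • x = y}` compact. Primitivity
is used only to make nontrivial normal subgroups transitive.

The candidate B is `closedMonolith G`, the intersection of all nontrivial closed normal subgroups.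
Transitive subgroups contain finitely generated transitive ones (`exists_finset_isTransOn`), so an
abelian normal subgroup would be regular and finitely generated, and its squares would force it to
be finite (`eq_bot_of_abelian`). Two normal subgroups meeting trivially would be regular with finite
conjugacy classes, which leads back to an abelian normal subgroup (`inf_ne_bot`). Compactness then
gives B ≠ 1; B is nonabelian with trivial centralizer, and [B, B] is dense in B.

Ends enter through `false_of_commuting`: nontrivial subgroups M₁, M₂ normalised by B never commute.
Density of [B, B] kills the displacement homomorphism of B along a fixed end, so B fixes no end
(`false_of_fixed_end`). Hence the kernel of the action on ends is trivial and the Mᵢ have infinite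
orbits. An M₁-orbit accumulates at an end fixed by M₂, and then M₂ fixes the whole B-orbit of that
end. Three fixed ends would make M₂-orbits finite, while on at most two ends B acts trivially; both
are impossible.

For simplicity (`le_of_normalised`), let M be a proper nontrivial closed normal subgroup of B. Its
G-core is trivial, yet finite intersections of its conjugates are not, since otherwise two of them
would commute. By compactness some such intersection is semiregular, which forces finite point
stabilisers. As G = B·Gₓ, M has finitely many conjugates, so its core is nontrivial, a
contradiction. -/

section Groups

/-! ### Normal subgroups of groups acting on locally finite graphs. -/

variable {G Ω : Type*} [Group G] [MulAction G Ω]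

/-- The elements of `H` permute `Ω` transitively. -/
def IsTransOn (H : Subgroup G) (Ω : Type*) [MulAction G Ω] : Prop :=
  ∀ x y : Ω, ∃ g ∈ H, g • x = y

/-- All suborbits are finite, and so are their translates. -/
def HasFiniteSuborbits (G Ω : Type*) [Group G] [MulAction G Ω] : Prop :=
  ∀ x y z : Ω, {w : Ω | ∃ g : G, g • x = z ∧ g • y = w}.Finite

/-- A connected, locally finite graph on which `G` acts by automorphisms. -/
structure IsInvariantGraph (G : Type*) {Ω : Type*} [Group G] [MulAction G Ω]
    (Γ : SimpleGraph Ω) : Prop where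
  connected : Γ.Connected
  locallyFinite : ∀ x, (Γ.neighborSet x).Finite
  adj_smul : ∀ (g : G) {x y : Ω}, Γ.Adj x y → Γ.Adj (g • x) (g • y)

/-- A group acting transitively on a connected locally finite graph has a finitely generated
subgroup that is transitive. -/
theorem IsInvariantGraph.exists_finset_isTransOn {Γ : SimpleGraph Ω} (hΓ : IsInvariantGraph G Γ)
    {T : Subgroup G} (hT : IsTransOn T Ω) :
    ∃ S : Finset G, (S : Set G) ⊆ T ∧ IsTransOn (Subgroup.closure (S : Set G)) Ω := by
  classical
  obtain ⟨a⟩ := hΓ.connected.nonempty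
  choose t htT ht using hT a
  refine ⟨(hΓ.locallyFinite a).toFinset.image t, ?_, ?_⟩
  · intro s hs
    simp only [Finset.coe_image, Set.mem_image] at hs
    obtain ⟨b, -, rfl⟩ := hs
    exact htT b
  · set H := Subgroup.closure (((hΓ.locallyFinite a).toFinset.image t : Finset G) : Set G)
    have key : ∀ y, ∃ g ∈ H, g • a = y := by
      intro y
      obtain ⟨p⟩ := hΓ.connected.preconnected y a
      induction p with
      | nil => exact ⟨1, H.one_mem, one_smul _ _⟩
      | cons hadj _ ih =>
        obtain ⟨g, hg, hga⟩ := ih ht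
        rename_i u v w q
        -- Here `w` is the base point `a`: pulling the edge back by `g` makes it an edge at `a`,
        -- where a generator is available.
        have h1 : Γ.Adj w (g⁻¹ • u) := by
          have := hΓ.adj_smul g⁻¹ hadj
          rw [← hga, inv_smul_smul] at this
          exact this.symm
        refine ⟨g * t (g⁻¹ • u), H.mul_mem hg (Subgroup.subset_closure ?_), ?_⟩
        · exact Finset.mem_image_of_mem t ((Set.Finite.mem_toFinset _).2 h1)
        · rw [mul_smul, ht, smul_inv_smul]
    intro x y
    obtain ⟨g, hg, hgx⟩ := key x
    obtain ⟨k, hk, hky⟩ := key y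
    exact ⟨k * g⁻¹, H.mul_mem hk (H.inv_mem hg), by rw [mul_smul, ← hgx, inv_smul_smul, hky]⟩

/-- An element commuting with a transitive group carries one fixed point to all points. -/
theorem IsTransOn.eq_one_of_commute [FaithfulSMul G Ω] {H : Subgroup G} (hH : IsTransOn H Ω)
    {n : G} (hn : ∀ h ∈ H, n * h = h * n) {x : Ω} (hx : n • x = x) : n = 1 := by
  refine FaithfulSMul.eq_of_smul_eq_smul (α := Ω) fun y => ?_
  obtain ⟨h, hh, rfl⟩ := hH x y
  rw [← mul_smul, hn h hh, mul_smul, hx, one_smul]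

theorem IsTransOn.eq_one_of_commute_closure [FaithfulSMul G Ω] {S : Set G}
    (hS : IsTransOn (Subgroup.closure S) Ω) {n : G} (hn : ∀ s ∈ S, n * s = s * n) {x : Ω}
    (hx : n • x = x) : n = 1 := by
  refine hS.eq_one_of_commute (fun h hh => ?_) hx
  have : Subgroup.closure S ≤ Subgroup.centralizer {n} :=
    (Subgroup.closure_le _).2 fun s hs => Subgroup.mem_centralizer_singleton_iff.2 (hn s hs).symm
  exact (Subgroup.mem_centralizer_singleton_iff.1 (this hh)).symm

/-- If finitely many elements have finite conjugacy classes under an infinite set `U`, then two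
distinct elements of `U` conjugate all of them in the same way. -/
theorem exists_ne_commute {U : Set G} (hU : U.Infinite) (S : Finset G)
    (h : ∀ s ∈ S, ((fun u => u * s * u⁻¹) '' U).Finite) :
    ∃ u ∈ U, ∃ v ∈ U, u ≠ v ∧ ∀ s ∈ S, u⁻¹ * v * s = s * (u⁻¹ * v) := by
  have hmaps : Set.MapsTo (fun (u : G) (s : {s // s ∈ S}) => u * (s : G) * u⁻¹) U
      (Set.pi Set.univ fun s : {s // s ∈ S} => (fun u => u * (s : G) * u⁻¹) '' U) :=
    fun u hu s _ => ⟨u, hu, rfl⟩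
  obtain ⟨u, hu, v, hv, huv, he⟩ := hU.exists_ne_map_eq_of_mapsTo hmaps
    (Set.Finite.pi fun s => h s s.2)
  refine ⟨u, hu, v, hv, huv, fun s hs => ?_⟩
  have h1 : u * s * u⁻¹ = v * s * v⁻¹ := congrFun he ⟨s, hs⟩
  have h2 : v * s = u * s * u⁻¹ * v := by rw [h1]; group
  calc u⁻¹ * v * s = u⁻¹ * (v * s) := by group
    _ = s * (u⁻¹ * v) := by rw [h2]; group

/-- In both cases one nonzero integer kills A: 2 itself, or, if A = 2A, an odd integer supplied by
Nakayama's lemma. A finitely generated torsion abelian group is finite. -/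
theorem finite_of_fg_of_sq {A : Type*} [CommGroup A] [Group.FG A]
    (h : (∀ a : A, a ^ 2 = 1) ∨ ∀ a : A, ∃ b, b ^ 2 = a) : Finite A := by
  obtain ⟨r, hr0, hr⟩ : ∃ r : ℤ, r ≠ 0 ∧ ∀ a : A, a ^ r = 1 := by
    rcases h with h | h
    · exact ⟨2, two_ne_zero, fun a => by exact_mod_cast h a⟩
    · have : Module.Finite ℤ (Additive A) := Module.Finite.iff_addGroup_fg.2 inferInstance
      obtain ⟨r, hr, hr'⟩ := Submodule.exists_sub_one_mem_and_smul_eq_zero_of_fg_of_le_smul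
        (Ideal.span {(2 : ℤ)}) (⊤ : Submodule ℤ (Additive A)) Module.Finite.fg_top (by
          intro a _
          obtain ⟨b, hb⟩ := h a.toMul
          have : a = (2 : ℤ) • Additive.ofMul b := by
            apply Additive.toMul.injective
            rw [← hb]
            exact (zpow_natCast b 2).symm
          rw [this]
          exact Submodule.smul_mem_smul (Ideal.mem_span_singleton_self 2) trivial)
      refine ⟨r, ?_, fun a => ?_⟩
      · rintro rfl
        rw [Ideal.mem_span_singleton] at hr
        omega
      · have := hr' (Additive.ofMul a) trivial
        exact congrArg Additive.toMul this
  refine CommGroup.finite_of_fg_isMulTorsion _ fun a => ?_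
  rw [isOfFinOrder_iff_zpow_eq_one]
  exact ⟨r, hr0, hr a⟩

theorem closure_eq_of_isTransOn_of_regular [Nonempty Ω] {N : Subgroup G} {S : Set G}
    (hSN : S ⊆ N) (hS : IsTransOn (Subgroup.closure S) Ω)
    (hN : ∀ n ∈ N, ∀ x : Ω, n • x = x → n = 1) : Subgroup.closure S = N := by
  refine le_antisymm ((Subgroup.closure_le _).2 hSN) fun n hn => ?_
  obtain ⟨x⟩ := ‹Nonempty Ω›
  obtain ⟨s, hs, hsx⟩ := hS x (n • x)
  have h1 : s⁻¹ * n = 1 := hN _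
    (N.mul_mem (N.inv_mem ((Subgroup.closure_le _).2 hSN hs)) hn) x
    (by rw [mul_smul, ← hsx, inv_smul_smul])
  rwa [← inv_mul_eq_one.1 h1]

variable [FaithfulSMul G Ω] [Infinite Ω] {Γ : SimpleGraph Ω}

/-- An infinite group all of whose nontrivial normal subgroups are transitive has no nontrivial
abelian normal subgroup, if it acts on a connected locally finite graph. -/
theorem IsInvariantGraph.eq_bot_of_abelian (hΓ : IsInvariantGraph G Γ)
    (hprim : ∀ N : Subgroup G, N.Normal → N ≠ ⊥ → IsTransOn N Ω)
    {N : Subgroup G} (hN : N.Normal) (hab : ∀ a ∈ N, ∀ b ∈ N, a * b = b * a) : N = ⊥ := by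
  by_contra hne
  have htr := hprim N hN hne
  obtain ⟨x⟩ := hΓ.connected.nonempty
  have hreg : ∀ n ∈ N, ∀ x : Ω, n • x = x → n = 1 := fun n hn x hx =>
    htr.eq_one_of_commute (fun h hh => hab n hn h hh) hx
  obtain ⟨S, hSN, hS⟩ := hΓ.exists_finset_isTransOn htr
  have hcl := closure_eq_of_isTransOn_of_regular hSN hS hreg
  let _ : CommGroup N :=
    { (inferInstance : Group N) with mul_comm := fun a b => Subtype.ext (hab a a.2 b b.2) }
  have : Group.FG N := (Group.fg_iff_subgroup_fg N).2 ⟨S, hcl⟩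
  -- The squares form a normal subgroup of `G`. If it is nontrivial it is transitive, and regularity
  -- of `N` makes it all of `N`.
  have hsq : (∀ a : N, a ^ 2 = 1) ∨ ∀ a : N, ∃ b, b ^ 2 = a := by
    set Q : Subgroup G := (powMonoidHom 2 : N →* N).range.map N.subtype with hQ
    have hQmem : ∀ g, g ∈ Q ↔ ∃ n ∈ N, n ^ 2 = g := by
      intro g
      simp only [hQ, Subgroup.mem_map, MonoidHom.mem_range]
      constructor
      · rintro ⟨_, ⟨b, rfl⟩, rfl⟩
        exact ⟨b, b.2, rfl⟩
      · rintro ⟨n, hn, rfl⟩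
        exact ⟨_, ⟨⟨n, hn⟩, rfl⟩, rfl⟩
    have hQn : Q.Normal := ⟨fun q hq g => by
      rw [hQmem] at hq ⊢
      obtain ⟨n, hn, rfl⟩ := hq
      exact ⟨g * n * g⁻¹, hN.conj_mem n hn g, by rw [conj_pow]⟩⟩
    by_cases hQb : Q = ⊥
    · left
      intro a
      have : (a : G) ^ 2 ∈ Q := (hQmem _).2 ⟨a, a.2, rfl⟩
      rw [hQb, Subgroup.mem_bot] at this
      exact Subtype.ext this
    · right
      intro a
      obtain ⟨q, hq, hqx⟩ := hprim Q hQn hQb x ((a : G) • x)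
      obtain ⟨n, hn, rfl⟩ := (hQmem _).1 hq
      have h1 : (n ^ 2)⁻¹ * a = 1 := hreg _ (N.mul_mem (N.inv_mem (N.pow_mem hn 2)) a.2) x
        (by rw [mul_smul, ← hqx, inv_smul_smul])
      exact ⟨⟨n, hn⟩, Subtype.ext (inv_mul_eq_one.1 h1)⟩
  have : Finite N := finite_of_fg_of_sq hsq
  have hsurj : Function.Surjective fun n : N => (n : G) • x := fun y => by
    obtain ⟨n, hn, h⟩ := htr x y
    exact ⟨⟨n, hn⟩, h⟩
  exact not_finite_iff_infinite.2 ‹Infinite Ω› (Finite.of_surjective _ hsurj)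

/-- Under the same hypotheses any two nontrivial normal subgroups intersect nontrivially. -/
theorem IsInvariantGraph.inf_ne_bot (hΓ : IsInvariantGraph G Γ)
    (hfin : HasFiniteSuborbits G Ω)
    (hprim : ∀ N : Subgroup G, N.Normal → N ≠ ⊥ → IsTransOn N Ω)
    {N₁ N₂ : Subgroup G} (h₁ : N₁.Normal) (h₂ : N₂.Normal) (hb₁ : N₁ ≠ ⊥) (hb₂ : N₂ ≠ ⊥) :
    N₁ ⊓ N₂ ≠ ⊥ := by
  intro hbot
  have hcomm : ∀ a ∈ N₁, ∀ b ∈ N₂, a * b = b * a := fun a ha b hb =>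
    Subgroup.commute_of_normal_of_disjoint N₁ N₂ h₁ h₂ (disjoint_iff.2 hbot) a b ha hb
  have t₁ := hprim N₁ h₁ hb₁
  have t₂ := hprim N₂ h₂ hb₂
  obtain ⟨x⟩ := hΓ.connected.nonempty
  have hreg : ∀ n ∈ N₁, ∀ x : Ω, n • x = x → n = 1 := fun n hn x hx =>
    t₂.eq_one_of_commute (fun h hh => hcomm n hn h hh) hx
  obtain ⟨S, hSN, hS⟩ := hΓ.exists_finset_isTransOn t₁
  have hcl := closure_eq_of_isTransOn_of_regular hSN hS hreg
  have hclass : ∀ s ∈ S, ((fun u => u * s * u⁻¹) '' (N₁ : Set G)).Finite := by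
    intro s hs
    refine Set.Finite.of_finite_image (f := fun g : G => g • x) ?_ ?_
    · refine (hfin x (s • x) x).subset ?_
      rintro _ ⟨_, ⟨n, hn, rfl⟩, rfl⟩
      -- Since `m` commutes with `s`, conjugating `s` by `n` or by `n * m` gives the same element;
      -- as `n * m` fixes `x`, that element maps `x` into a suborbit.
      obtain ⟨m, hm, hmx⟩ := t₂ x (n⁻¹ • x)
      have hnm := hcomm n hn m hm
      refine ⟨n * m, by rw [mul_smul, hmx, smul_inv_smul], ?_⟩
      have hsm := hcomm s (hSN hs) m hm
      show (n * m) • s • x = (n * s * n⁻¹) • x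
      rw [mul_smul, ← mul_smul m, ← hsm, mul_smul s, hmx]
      simp only [mul_smul]
    · rintro _ ⟨u, hu, rfl⟩ _ ⟨v, hv, rfl⟩ (he : (u * s * u⁻¹) • x = (v * s * v⁻¹) • x)
      have h1 : u * s * u⁻¹ ∈ N₁ := h₁.conj_mem _ (hSN hs) u
      have h2 : v * s * v⁻¹ ∈ N₁ := h₁.conj_mem _ (hSN hs) v
      have := hreg _ (N₁.mul_mem (N₁.inv_mem h2) h1) x (by rw [mul_smul, he, inv_smul_smul])
      exact (inv_mul_eq_one.1 this).symm
  have hinf : (N₁ : Set G).Infinite := by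
    intro hf
    have : (Set.univ : Set Ω) ⊆ (fun g : G => g • x) '' (N₁ : Set G) := fun y _ => by
      obtain ⟨n, hn, h⟩ := t₁ x y
      exact ⟨n, hn, h⟩
    exact Set.infinite_univ ((hf.image _).subset this)
  obtain ⟨u, hu, v, hv, huv, hc⟩ := exists_ne_commute hinf S hclass
  -- A nontrivial element of the centre of `N₁`, which is an abelian normal subgroup of `G`.
  have hcen : u⁻¹ * v ∈ Subgroup.centralizer (N₁ : Set G) := by
    rw [← hcl, Subgroup.centralizer_closure]
    exact Subgroup.mem_centralizer_iff.2 fun s hs => (hc s hs).symm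
  have hmem : u⁻¹ * v ∈ N₁ ⊓ Subgroup.centralizer (N₁ : Set G) :=
    ⟨N₁.mul_mem (N₁.inv_mem hu) hv, hcen⟩
  have hz := hΓ.eq_bot_of_abelian hprim (N := N₁ ⊓ Subgroup.centralizer (N₁ : Set G))
    inferInstance (fun a ha b hb => Subgroup.mem_centralizer_iff.1 hb.2 a ha.1)
  rw [hz, Subgroup.mem_bot] at hmem
  exact huv (inv_mul_eq_one.1 hmem)

end Groups

/-! ### Cuts, connected sets and counts of separating cuts. -/

section Cuts

open scoped Pointwise

variable {G Ω : Type*} [Group G] [MulAction G Ω] {Γ : SimpleGraph Ω}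

/-- The end points of the edges of `Γ` between `A` and its complement. -/
def cutVerts (Γ : SimpleGraph Ω) (A : Set Ω) : Set Ω :=
  {v | ∃ w, Γ.Adj v w ∧ ¬(v ∈ A ↔ w ∈ A)}

/-- A cut is a set of vertices with finite boundary. -/
def IsCut (Γ : SimpleGraph Ω) (A : Set Ω) : Prop :=
  (cutVerts Γ A).Finite

/-- The set `X` is connected: a set that no edge inside `X` leaves contains all or nothing of it. -/
def IsConnSet (Γ : SimpleGraph Ω) (X : Set Ω) : Prop :=
  ∀ D : Set Ω, (∀ x ∈ X, ∀ y ∈ X, Γ.Adj x y → x ∈ D → y ∈ D) → ∀ x ∈ X, ∀ y ∈ X, x ∈ D → y ∈ D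

theorem cutVerts_compl (A : Set Ω) : cutVerts Γ Aᶜ = cutVerts Γ A := by
  ext v
  simp only [cutVerts, Set.mem_ofPred_eq, Set.mem_compl_iff, not_iff_not]

theorem IsCut.compl {A : Set Ω} (h : IsCut Γ A) : IsCut Γ Aᶜ := by
  rwa [IsCut, cutVerts_compl]

theorem IsCut.inter {A C : Set Ω} (hA : IsCut Γ A) (hC : IsCut Γ C) : IsCut Γ (A ∩ C) := by
  refine (hA.union hC).subset ?_
  rintro v ⟨w, hw, h⟩
  by_contra hn
  simp only [Set.mem_union, not_or, cutVerts, Set.mem_ofPred_eq, not_exists, not_and, not_not] at hn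
  exact h (and_congr (hn.1 w hw) (hn.2 w hw))

theorem IsInvariantGraph.cutVerts_smul (hΓ : IsInvariantGraph G Γ) (g : G) (A : Set Ω) :
    cutVerts Γ (g • A) = g • cutVerts Γ A := by
  ext v
  simp only [Set.mem_smul_set_iff_inv_smul_mem, cutVerts, Set.mem_ofPred_eq]
  constructor
  · rintro ⟨w, hw, h⟩
    exact ⟨g⁻¹ • w, hΓ.adj_smul _ hw, h⟩
  · rintro ⟨w, hw, h⟩
    refine ⟨g • w, ?_, by rwa [inv_smul_smul]⟩
    simpa using hΓ.adj_smul g hw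

theorem IsInvariantGraph.isCut_smul (hΓ : IsInvariantGraph G Γ) (g : G) {A : Set Ω}
    (hA : IsCut Γ A) : IsCut Γ (g • A) := by
  rw [IsCut, hΓ.cutVerts_smul]
  exact hA.smul_set

theorem IsInvariantGraph.isConnSet_smul (hΓ : IsInvariantGraph G Γ) (g : G) {X : Set Ω}
    (hX : IsConnSet Γ X) : IsConnSet Γ (g • X) := by
  intro D hD x hx y hy hxD
  rw [Set.mem_smul_set_iff_inv_smul_mem] at hx hy
  have := hX (g⁻¹ • D) (fun u hu v hv huv huD => by
    rw [Set.mem_smul_set_iff_inv_smul_mem, inv_inv] at huD ⊢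
    exact hD _ (Set.smul_mem_smul_set hu) _ (Set.smul_mem_smul_set hv) (hΓ.adj_smul g huv) huD)
    _ hx _ hy (Set.smul_mem_smul_set hxD)
  rwa [Set.mem_smul_set_iff_inv_smul_mem, inv_inv, smul_inv_smul] at this

theorem IsConnSet.of_induce {X : Set Ω} (h : (Γ.induce X).Preconnected) : IsConnSet Γ X := by
  intro D hD x hx y hy hxD
  obtain ⟨p⟩ := h ⟨x, hx⟩ ⟨y, hy⟩
  have key : ∀ u v : X, (Γ.induce X).Walk u v → (u : Ω) ∈ D → (v : Ω) ∈ D := by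
    intro u v p
    induction p with
    | nil => exact id
    | cons hadj _ ih => exact fun hu => ih (hD _ (Subtype.prop _) _ (Subtype.prop _) hadj hu)
  exact key _ _ p hxD

theorem isConnSet_univ (h : Γ.Connected) : IsConnSet Γ Set.univ := by
  intro D hD x _ y _ hxD
  obtain ⟨p⟩ := h.preconnected x y
  induction p with
  | nil => exact hxD
  | cons hadj _ ih => exact ih trivial trivial (hD _ trivial _ trivial hadj hxD)

/-- Encloses finite boundaries in a finite connected set F; a translate of F that misses the
boundary of a cut lies on one side of it. -/
theorem exists_finite_isConnSet (h : Γ.Connected) {T : Set Ω} (hT : T.Finite) :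
    ∃ F : Set Ω, F.Finite ∧ T ⊆ F ∧ F.Nonempty ∧ IsConnSet Γ F := by
  classical
  obtain ⟨x⟩ := h.nonempty
  obtain ⟨F, hF, hc⟩ := SimpleGraph.extend_finset_to_connected h.preconnected
    (t := insert x hT.toFinset) (Finset.insert_nonempty _ _)
  refine ⟨F, F.finite_toSet, fun y hy => hF ?_, ⟨x, hF (Finset.mem_insert_self _ _)⟩,
    .of_induce hc.preconnected⟩
  exact Finset.mem_insert_of_mem (hT.mem_toFinset.2 hy)

theorem IsConnSet.subset_or {X A : Set Ω} (hX : IsConnSet Γ X) (h : Disjoint X (cutVerts Γ A)) :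
    X ⊆ A ∨ X ⊆ Aᶜ := by
  by_cases hne : ∃ x ∈ X, x ∈ A
  · obtain ⟨x, hx, hxA⟩ := hne
    refine Or.inl fun y hy => hX A (fun u hu v _ huv huA => ?_) x hx y hy hxA
    by_contra hv
    exact Set.disjoint_left.1 h hu ⟨v, huv, by tauto⟩
  · exact Or.inr fun x hx hxA => hne ⟨x, hx, hxA⟩

/-- A path in Γ can enter or leave A only through F, and F is itself connected. -/
theorem IsConnSet.union_of_cutVerts_subset (h : Γ.Connected) {F A : Set Ω} (hF : IsConnSet Γ F)
    (hne : F.Nonempty) (hA : cutVerts Γ A ⊆ F) : IsConnSet Γ (A ∪ F) := by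
  obtain ⟨f, hf⟩ := hne
  have key : ∀ D : Set Ω, (∀ x ∈ A ∪ F, ∀ y ∈ A ∪ F, Γ.Adj x y → x ∈ D → y ∈ D) →
      ∀ y ∈ A ∪ F, (f ∈ D ↔ y ∈ D) := by
    intro D hD
    have hFD : ∀ y ∈ F, (f ∈ D ↔ y ∈ D) := by
      have h1 := hF D fun x hx y hy => hD x (Or.inr hx) y (Or.inr hy)
      exact fun y hy => ⟨h1 f hf y hy, h1 y hy f hf⟩
    have h2 := isConnSet_univ h {y | y ∈ A ∪ F → (f ∈ D ↔ y ∈ D)} (by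
      intro u _ v _ huv hu hv
      by_cases hvF : v ∈ F
      · exact hFD v hvF
      have hvA : v ∈ A := hv.resolve_right hvF
      have huA : u ∈ A := by
        by_contra hu'
        exact hvF (hA ⟨u, huv.symm, by tauto⟩)
      rw [hu (Or.inl huA)]
      exact ⟨hD u (Or.inl huA) v hv huv, hD v hv u (Or.inl huA) huv.symm⟩)
    exact fun y hy => h2 f trivial y trivial (fun _ => Iff.rfl) hy
  intro D hD x hx y hy hxD
  exact (key D hD y hy).1 ((key D hD x hx).2 hxD)

/-- A cut is determined by its boundary: fixing the boundary pointwise fixes the cut. -/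
theorem IsInvariantGraph.smul_eq_of_fixing (hΓ : IsInvariantGraph G Γ) {F A : Set Ω}
    (hne : F.Nonempty) (hA : cutVerts Γ A ⊆ F) {g : G} (hg : ∀ x ∈ F, g • x = x) : g • A = A := by
  obtain ⟨f, hf⟩ := hne
  have hg' : ∀ x, g⁻¹ • x ∈ F → g⁻¹ • x = x := fun x hx => by
    have := hg _ hx
    rw [smul_inv_smul] at this
    exact this.symm
  have hinv : ∀ x ∈ F, g⁻¹ • x = x := fun x hx => inv_smul_eq_iff.2 (hg x hx).symm
  have h := isConnSet_univ hΓ.connected {v | v ∈ A ↔ g⁻¹ • v ∈ A} (by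
    intro u _ v _ huv hu
    by_cases h1 : u ∈ A ↔ v ∈ A
    · by_cases h2 : g⁻¹ • u ∈ A ↔ g⁻¹ • v ∈ A
      · exact h1.symm.trans (Iff.trans hu h2)
      · have h3 : g⁻¹ • v ∈ F :=
          hA ⟨g⁻¹ • u, (hΓ.adj_smul g⁻¹ huv).symm, fun h => h2 h.symm⟩
        show v ∈ A ↔ g⁻¹ • v ∈ A
        rw [hg' v h3]
    · have h3 : v ∈ F := hA ⟨u, huv.symm, fun h => h1 h.symm⟩
      show v ∈ A ↔ g⁻¹ • v ∈ A
      rw [hinv v h3])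
  ext v
  rw [Set.mem_smul_set_iff_inv_smul_mem]
  exact (h f trivial v trivial (show f ∈ A ↔ g⁻¹ • f ∈ A by rw [hinv f hf])).symm

theorem HasFiniteSuborbits.finite_smul (hfin : HasFiniteSuborbits G Ω) {F P : Set Ω}
    (hF : F.Finite) (hP : P.Finite) (x : Ω) :
    {y | ∃ c : G, (∃ f ∈ F, c • f ∈ P) ∧ c • x = y}.Finite := by
  refine (hF.biUnion fun f _ => hP.biUnion fun p _ => hfin f x p).subset ?_
  rintro y ⟨c, ⟨f, hf, hp⟩, rfl⟩
  exact Set.mem_biUnion hf (Set.mem_biUnion hp ⟨c, rfl, rfl⟩)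

/-- The translate `c • A` depends only on the restriction of `c` to F, and there are finitely many
such restrictions once some point of F is sent into P. -/
theorem HasFiniteSuborbits.finite_smul_cut (hfin : HasFiniteSuborbits G Ω)
    (hΓ : IsInvariantGraph G Γ) {F P A : Set Ω} (hF : F.Finite) (hne : F.Nonempty)
    (hA : cutVerts Γ A ⊆ F) (hP : P.Finite) :
    {C | ∃ c : G, (∃ f ∈ F, c • f ∈ P) ∧ c • A = C}.Finite := by
  have := hF.to_subtype
  set K : Set G := {c | ∃ f ∈ F, c • f ∈ P}
  set r : G → F → Ω := fun c t => c • (t : Ω) with hr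
  have h1 : (r '' K).Finite := by
    refine (Set.Finite.pi fun t : F => hfin.finite_smul hF hP (t : Ω)).subset ?_
    rintro _ ⟨c, hc, rfl⟩ t -
    exact ⟨c, hc, rfl⟩
  refine (h1.image fun s => Function.invFunOn r K s • A).subset ?_
  rintro _ ⟨c, hc, rfl⟩
  refine ⟨r c, ⟨c, hc, rfl⟩, ?_⟩
  set d := Function.invFunOn r K (r c)
  have hd : r d = r c := Function.invFunOn_eq ⟨c, hc, rfl⟩
  have h2 : (c⁻¹ * d) • A = A := hΓ.smul_eq_of_fixing hne hA fun x hx => by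
    have : d • x = c • x := congrFun hd ⟨x, hx⟩
    rw [mul_smul, this, inv_smul_smul]
  rw [mul_smul, inv_smul_eq_iff] at h2
  exact h2

/-- Only finitely many translates of a finite set are separated by a cut. -/
theorem HasFiniteSuborbits.finite_crossing (hfin : HasFiniteSuborbits G Ω)
    (hΓ : IsInvariantGraph G Γ) {T A : Set Ω} (hT : T.Finite) (hA : IsCut Γ A) (x : Ω) :
    {y | ∃ c : G, (∃ s ∈ T, ∃ t ∈ T, c • s ∈ A ∧ c • t ∉ A) ∧ c • x = y}.Finite := by
  obtain ⟨F, hF, hTF, -, hconn⟩ := exists_finite_isConnSet hΓ.connected hT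
  refine (hfin.finite_smul hF hA x).subset ?_
  rintro y ⟨c, ⟨s, hs, t, ht, hsA, htA⟩, rfl⟩
  refine ⟨c, ?_, rfl⟩
  by_contra hcon
  push Not at hcon
  have hdis : Disjoint (c • F) (cutVerts Γ A) := by
    rw [Set.disjoint_left]
    rintro _ ⟨f, hf, rfl⟩
    exact hcon f hf
  rcases (hΓ.isConnSet_smul c hconn).subset_or hdis with h | h
  · exact htA (h (Set.smul_mem_smul_set (hTF ht)))
  · exact h (Set.smul_mem_smul_set (hTF hs)) hsA

/-- Within the finite family separating some two of the three points, each difference of counts is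
the number of members containing the first point minus the number containing the second; these
telescope. -/
theorem ncard_separating_add (O : Set (Set Ω)) (hO : ∀ x y, {C ∈ O | x ∈ C ∧ y ∉ C}.Finite)
    (x y z : Ω) :
    ((Set.ncard {C ∈ O | x ∈ C ∧ y ∉ C} : ℤ) - Set.ncard {C ∈ O | y ∈ C ∧ x ∉ C}) +
      (Set.ncard {C ∈ O | y ∈ C ∧ z ∉ C} - Set.ncard {C ∈ O | z ∈ C ∧ y ∉ C}) =
      Set.ncard {C ∈ O | x ∈ C ∧ z ∉ C} - Set.ncard {C ∈ O | z ∈ C ∧ x ∉ C} := by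
  classical
  set s : Set Ω := {x, y, z} with hs
  have hsf : s.Finite := by simp [hs]
  have hΦ : (⋃ u ∈ s, ⋃ v ∈ s, {C ∈ O | u ∈ C ∧ v ∉ C}).Finite :=
    hsf.biUnion fun u _ => hsf.biUnion fun v _ => hO u v
  set Φ := hΦ.toFinset
  have h1 : ∀ u ∈ s, ∀ v ∈ s, Set.ncard {C ∈ O | u ∈ C ∧ v ∉ C} =
      (Φ.filter fun C => u ∈ C ∧ v ∉ C).card := by
    intro u hu v hv
    rw [← Set.ncard_coe_finset]
    congr 1
    ext C
    simp only [Finset.coe_filter, Set.mem_ofPred_eq]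
    constructor
    · rintro ⟨hC, h⟩
      exact ⟨hΦ.mem_toFinset.2 (Set.mem_biUnion hu (Set.mem_biUnion hv ⟨hC, h⟩)), h⟩
    · rintro ⟨hC, h⟩
      refine ⟨?_, h⟩
      have := hΦ.mem_toFinset.1 hC
      simp only [Set.mem_iUnion] at this
      obtain ⟨_, _, _, _, h⟩ := this
      exact h.1
  have h2 : ∀ u v, ((Φ.filter fun C => u ∈ C ∧ v ∉ C).card : ℤ) +
      (Φ.filter fun C => u ∈ C ∧ v ∈ C).card = (Φ.filter fun C => u ∈ C).card := by
    intro u v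
    rw [← Finset.card_filter_add_card_filter_not (s := Φ.filter fun C => u ∈ C) (fun C => v ∈ C),
      Finset.filter_filter, Finset.filter_filter]
    push_cast
    ring
  have h3 : ∀ u v, (Φ.filter fun C => u ∈ C ∧ v ∈ C) = Φ.filter fun C => v ∈ C ∧ u ∈ C :=
    fun u v => Finset.filter_congr fun _ _ => and_comm
  have h4 : ∀ u ∈ s, ∀ v ∈ s, ((Set.ncard {C ∈ O | u ∈ C ∧ v ∉ C} : ℤ) -
      Set.ncard {C ∈ O | v ∈ C ∧ u ∉ C}) =
      (Φ.filter fun C => u ∈ C).card - (Φ.filter fun C => v ∈ C).card := by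
    intro u hu v hv
    rw [h1 u hu v hv, h1 v hv u hu, ← h2 u v, ← h2 v u, h3 v u]
    ring
  have hx : x ∈ s := by simp [hs]
  have hy : y ∈ s := by simp [hs]
  have hz : z ∈ s := by simp [hs]
  rw [h4 x hx y hy, h4 y hy z hz, h4 x hx z hz]
  ring

end Cuts

/-! ### Actions on ends. An end is represented by an ultrafilter, of which only the cuts it contains
matter. -/

section Ends

open scoped Pointwise

variable {G Ω : Type*} [Group G] [MulAction G Ω] {Γ : SimpleGraph Ω}

/-- Every subgroup of `B` that is open in the permutation topology and contains the commutators
of `B` is equal to `B`. -/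
def IsOpenlyPerfect (B : Subgroup G) (Ω : Type*) [MulAction G Ω] : Prop :=
  ∀ H : Subgroup G, H ≤ B → (∀ a ∈ B, ∀ b ∈ B, a * b * a⁻¹ * b⁻¹ ∈ H) →
    (∃ F : Set Ω, F.Finite ∧ ∀ b ∈ B, (∀ x ∈ F, b • x = x) → b ∈ H) → B ≤ H

/-- The kernel contains all commutators and a point stabiliser, so it is open and equals B. -/
theorem IsOpenlyPerfect.hom_eq_one {B : Subgroup G} (hB : IsOpenlyPerfect B Ω)
    {M : Type*} [CommGroup M] (φ : B →* M) (x : Ω)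
    (hφ : ∀ b : B, (b : G) • x = x → φ b = 1) (b : B) : φ b = 1 := by
  have h : B ≤ φ.ker.map B.subtype := by
    refine hB _ (Subgroup.map_subtype_le _) ?_ ⟨{x}, Set.finite_singleton x, ?_⟩
    · intro a ha b hb
      refine ⟨⟨a, ha⟩ * ⟨b, hb⟩ * ⟨a, ha⟩⁻¹ * ⟨b, hb⟩⁻¹, ?_, rfl⟩
      show φ _ = 1
      simp only [map_mul, map_inv]
      rw [mul_right_comm, mul_inv_cancel_right, mul_inv_cancel]
    · intro b hb hbx
      exact ⟨⟨b, hb⟩, hφ ⟨b, hb⟩ (hbx x rfl), rfl⟩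
  obtain ⟨c, hc, hcb⟩ := h b.2
  rw [← Subtype.ext (a1 := c) (a2 := b) hcb]
  exact hc

/-- Separation counts of the translates of a cut by an openly perfect group are symmetric on
orbits. -/
theorem IsOpenlyPerfect.ncard_separating_eq {B : Subgroup G} (hperf : IsOpenlyPerfect B Ω)
    {O : Set (Set Ω)} (hO : ∀ x y, {C ∈ O | x ∈ C ∧ y ∉ C}.Finite)
    (hOB : ∀ b ∈ B, ∀ C ∈ O, b • C ∈ O) (x : Ω) {b : G} (hb : b ∈ B) :
    Set.ncard {C ∈ O | b • x ∈ C ∧ x ∉ C} = Set.ncard {C ∈ O | x ∈ C ∧ b • x ∉ C} := by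
  set h : Ω → Ω → ℤ := fun x y =>
    (Set.ncard {C ∈ O | x ∈ C ∧ y ∉ C} : ℤ) - Set.ncard {C ∈ O | y ∈ C ∧ x ∉ C} with hdef
  have hadd : ∀ x y z, h x y + h y z = h x z := ncard_separating_add O hO
  have hinvN : ∀ b ∈ B, ∀ x y, Set.ncard {C ∈ O | b • x ∈ C ∧ b • y ∉ C} =
      Set.ncard {C ∈ O | x ∈ C ∧ y ∉ C} := by
    intro b hb x y
    rw [← Set.ncard_image_of_injective {C ∈ O | x ∈ C ∧ y ∉ C}
      (MulAction.injective (β := Set Ω) b)]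
    congr 1
    ext C
    constructor
    · rintro ⟨hC, h1, h2⟩
      refine ⟨b⁻¹ • C, ⟨hOB _ (B.inv_mem hb) C hC, ?_, ?_⟩, smul_inv_smul _ _⟩
      · rwa [Set.mem_smul_set_iff_inv_smul_mem, inv_inv]
      · rwa [Set.mem_smul_set_iff_inv_smul_mem, inv_inv]
    · rintro ⟨D, ⟨hD, h1, h2⟩, rfl⟩
      refine ⟨hOB b hb D hD, Set.smul_mem_smul_set h1, ?_⟩
      rwa [Set.mem_smul_set_iff_inv_smul_mem, inv_smul_smul]
  have hinv : ∀ b ∈ B, ∀ x y, h (b • x) (b • y) = h x y := by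
    intro b hb x y
    simp only [hdef, hinvN b hb]
  have hself : ∀ x, h x x = 0 := fun x => sub_self _
  -- Additivity and invariance of `h` make the displacement of `x` a homomorphism; it vanishes on
  -- the stabiliser of `x`.
  let φ : B →* Multiplicative ℤ :=
    { toFun := fun b => Multiplicative.ofAdd (h ((b : G) • x) x)
      map_one' := by
        show Multiplicative.ofAdd (h ((1 : G) • x) x) = 1
        rw [one_smul, hself]
        rfl
      map_mul' := fun a b => by
        show Multiplicative.ofAdd (h (((a : G) * b) • x) x) =
          Multiplicative.ofAdd (h ((a : G) • x) x + h ((b : G) • x) x)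
        rw [← hadd _ ((a : G) • x) x, mul_smul, hinv a a.2, add_comm] }
  have h1 : φ ⟨b, hb⟩ = 1 := hperf.hom_eq_one φ x (fun c hc => by
    show Multiplicative.ofAdd (h ((c : G) • x) x) = 1
    rw [hc, hself]
    rfl) ⟨b, hb⟩
  have h2 : h (b • x) x = 0 := congrArg Multiplicative.toAdd h1
  simp only [hdef] at h2
  omega

/-- An openly perfect group acting transitively on a graph with more than one end does not fix
an end. -/
theorem IsInvariantGraph.false_of_fixed_end (hΓ : IsInvariantGraph G Γ)
    (hfin : HasFiniteSuborbits G Ω) {B : Subgroup G} (hB : IsTransOn B Ω)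
    (hperf : IsOpenlyPerfect B Ω) {A₀ : Set Ω} (hA₀ : IsCut Γ A₀) (hinf : A₀.Infinite)
    (hinf' : A₀ᶜ.Infinite) (U : Ultrafilter Ω)
    (hU : ∀ b ∈ B, ∀ A, IsCut Γ A → A ∈ U → b • A ∈ U) : False := by
  obtain ⟨A, hA, hAU, hAinf⟩ : ∃ A, IsCut Γ A ∧ A ∈ U ∧ Aᶜ.Infinite := by
    rcases U.mem_or_compl_mem A₀ with h | h
    · exact ⟨A₀, hA₀, h, hinf'⟩
    · exact ⟨A₀ᶜ, hA₀.compl, h, by rwa [compl_compl]⟩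
  obtain ⟨x, hxA⟩ := hAinf.nonempty
  obtain ⟨F, hF, hAF, hne, hconn⟩ := exists_finite_isConnSet hΓ.connected
    (hA.union (Set.finite_singleton x))
  have hxF : x ∈ F := hAF (Or.inr rfl)
  replace hAF : cutVerts Γ A ⊆ F := Set.subset_union_left.trans hAF
  have hsub : ∀ c : G, cutVerts Γ (c • A) ⊆ c • F := fun c => by
    rw [hΓ.cutVerts_smul]
    exact Set.smul_set_mono hAF
  have hAc : IsConnSet Γ (A ∪ F) := hconn.union_of_cutVerts_subset hΓ.connected hne hAF
  have hAc' : IsConnSet Γ (Aᶜ ∪ F) :=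
    hconn.union_of_cutVerts_subset hΓ.connected hne (by rwa [cutVerts_compl])
  have hmeet : ∀ C D : Set Ω, C ∈ U → D ∈ U → ¬ C ⊆ Dᶜ := fun C D hC hD h => by
    obtain ⟨y, hy, hy'⟩ := U.nonempty_of_mem (Filter.inter_mem hC hD)
    exact h hy hy'
  -- a translation along the end
  obtain ⟨b, hb, hbF⟩ : ∃ b ∈ B, b • F ⊆ Aᶜ ∧ Disjoint F (b • F) := by
    -- Only finitely many images of `x` come from translates of `F` that meet `F`, whereas `Aᶜ` is
    -- infinite.
    obtain ⟨y, hyA, hy⟩ := (hAinf.sdiff (hfin.finite_smul hF hF x)).nonempty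
    obtain ⟨b, hb, rfl⟩ := hB x y
    have hdis : Disjoint F (b • F) := by
      rw [Set.disjoint_right]
      rintro _ ⟨f, hf, rfl⟩ h
      exact hy ⟨b, ⟨f, hf, h⟩, rfl⟩
    refine ⟨b, hb, ?_, hdis⟩
    rcases (hΓ.isConnSet_smul b hconn).subset_or (hdis.symm.mono_right hAF) with h | h
    · exact absurd (h (Set.smul_mem_smul_set hxF)) hyA
    · exact h
  obtain ⟨hbA, hbdis⟩ := hbF
  have hAb : A ∪ F ⊆ b • A := by
    have hdis : Disjoint (A ∪ F) (cutVerts Γ (b • A)) := by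
      refine Disjoint.mono_right (hsub b) ?_
      rw [Set.disjoint_union_left]
      exact ⟨Set.disjoint_left.2 fun y hy hy' => hbA hy' hy, hbdis⟩
    rcases hAc.subset_or hdis with h | h
    · exact h
    · exact absurd (Set.subset_union_left.trans h) (hmeet _ _ hAU (hU b hb A hA hAU))
  have hmono : Monotone fun n : ℕ => b ^ n • A := monotone_nat_of_le_succ fun n => by
    rw [pow_succ, mul_smul]
    exact Set.smul_set_mono (Set.subset_union_left.trans hAb)
  have hxn : ∀ n : ℕ, b ^ n • x ∉ b ^ n • A := fun n => by
    rwa [Set.smul_mem_smul_set_iff]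
  have hxn' : ∀ n : ℕ, b ^ n • x ∈ b ^ (n + 1) • A := fun n => by
    rw [pow_succ, mul_smul]
    exact Set.smul_mem_smul_set (hAb (Or.inr hxF))
  have hx1 : x ∈ b • A := hAb (Or.inr hxF)
  have hstrict : StrictMono fun n : ℕ => b ^ n • A := strictMono_nat_of_lt_succ fun n =>
    lt_of_le_of_ne (hmono n.le_succ) fun he => hxn n (by
      have := hxn' n
      rwa [← show b ^ n • A = b ^ (n + 1) • A from he] at this)
  -- the counts
  set O : Set (Set Ω) := {C | ∃ c ∈ B, c • A = C} with hOdef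
  have hOfin : ∀ x y, {C ∈ O | x ∈ C ∧ y ∉ C}.Finite := by
    intro u v
    obtain ⟨P, hP, huv, -, hPc⟩ := exists_finite_isConnSet hΓ.connected
      (Set.toFinite ({u, v} : Set Ω))
    refine (hfin.finite_smul_cut hΓ hF hne hAF hP).subset ?_
    rintro _ ⟨⟨c, hc, rfl⟩, hu, hv⟩
    refine ⟨c, ?_, rfl⟩
    by_contra hcon
    push Not at hcon
    have hdis : Disjoint P (cutVerts Γ (c • A)) := by
      refine Disjoint.mono_right (hsub c) ?_
      rw [Set.disjoint_right]
      rintro _ ⟨f, hf, rfl⟩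
      exact hcon f hf
    rcases hPc.subset_or hdis with h | h
    · exact hv (h (huv (by simp)))
    · exact h (huv (by simp)) hu
  have hOB : ∀ b ∈ B, ∀ C ∈ O, b • C ∈ O := by
    rintro b hb _ ⟨c, hc, rfl⟩
    exact ⟨b * c, B.mul_mem hb hc, mul_smul _ _ _⟩
  set R : Set (Set Ω) := {C ∈ O | b • x ∈ C ∧ x ∉ C} ∪
    {C | ∃ c : G, (∃ f ∈ F, c • f ∈ b • F) ∧ c • A = C}
  have hR : R.Finite :=
    (hOfin _ _).union (hfin.finite_smul_cut hΓ hF hne hAF hF.smul_set)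
  -- If `c • F` misses `b • F`, it lies on one side of `b • A`. Inside, `c • A` must contain all of
  -- `b • Aᶜ`, hence `b • x`; outside, `b • A` and `c • A` would be disjoint although both contain
  -- the end. So the count is bounded independently of `n`.
  have hupper : ∀ n : ℕ, 1 ≤ n → {C ∈ O | b ^ n • x ∈ C ∧ x ∉ C} ⊆ R := by
    rintro n hn _ ⟨⟨c, hc, rfl⟩, h1, h2⟩
    by_cases hcF : ∃ f ∈ F, c • f ∈ b • F
    · exact Or.inr ⟨c, hcF, rfl⟩
    push Not at hcF
    have hdis : Disjoint (c • F) (b • F) := by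
      rw [Set.disjoint_left]
      rintro _ ⟨f, hf, rfl⟩
      exact hcF f hf
    rcases (hΓ.isConnSet_smul c hconn).subset_or (hdis.mono_right (hsub b)) with h | h
    · left
      have h3 : b • (Aᶜ ∪ F) ⊆ c • A := by
        have hd : Disjoint (b • (Aᶜ ∪ F)) (cutVerts Γ (c • A)) := by
          refine Disjoint.mono_right (hsub c) ?_
          rw [Set.smul_set_union, Set.disjoint_union_left, Set.smul_set_compl]
          exact ⟨Set.disjoint_left.2 fun y hy hy' => hy (h hy'), hdis.symm⟩
        rcases (hΓ.isConnSet_smul b hAc').subset_or hd with h' | h'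
        · exact h'
        · refine absurd h1 (h' ?_)
          rw [Set.smul_set_union, Set.smul_set_compl]
          refine Or.inl fun h4 => hxn n (hmono hn ?_)
          simpa using h4
      exact ⟨⟨c, hc, rfl⟩, h3 (Set.smul_mem_smul_set (Or.inl hxA)), h2⟩
    · exfalso
      have hd : Disjoint (b • (A ∪ F)) (cutVerts Γ (c • A)) := by
        refine Disjoint.mono_right (hsub c) ?_
        rw [Set.smul_set_union, Set.disjoint_union_left]
        exact ⟨Set.disjoint_left.2 fun y hy hy' => h hy' hy, hdis.symm⟩
      rcases (hΓ.isConnSet_smul b hAc).subset_or hd with h' | h'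
      · exact h2 (h' (by rw [Set.smul_set_union]; exact Or.inl hx1))
      · refine hmeet _ _ (hU b hb A hA hAU) (hU c hc A hA hAU) (subset_trans ?_ h')
        rw [Set.smul_set_union]
        exact Set.subset_union_left
  -- The cuts `b ^ i • A` with 1 ≤ i ≤ n are distinct and all separate `x` from `b ^ n • x`, so the
  -- opposite count is unbounded.
  have hlower : ∀ n : ℕ, n ≤ Set.ncard {C ∈ O | x ∈ C ∧ b ^ n • x ∉ C} := by
    intro n
    have h1 : ((fun i : ℕ => b ^ i • A) '' Set.Icc 1 n) ⊆ {C ∈ O | x ∈ C ∧ b ^ n • x ∉ C} := by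
      rintro _ ⟨i, hi, rfl⟩
      refine ⟨⟨b ^ i, B.pow_mem hb i, rfl⟩, hmono hi.1 (by simpa using hx1), fun h => ?_⟩
      exact hxn n (hmono hi.2 h)
    have h2 := Set.ncard_le_ncard h1 (hOfin _ _)
    rw [Set.ncard_image_of_injective _ hstrict.injective] at h2
    simpa [Set.ncard_eq_toFinset_card'] using h2
  have h1 := hlower (R.ncard + 1)
  have h2 := Set.ncard_le_ncard (hupper (R.ncard + 1) (by omega)) hR
  rw [hperf.ncard_separating_eq hOfin hOB x (B.pow_mem hb _)] at h2
  omega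

theorem finite_symmDiff_trans {A C D : Set Ω} (h₁ : (symmDiff A C).Finite)
    (h₂ : (symmDiff C D).Finite) : (symmDiff A D).Finite :=
  (h₁.union h₂).subset (symmDiff_triangle A C D)

/-- The group of elements that preserve the set `A` up to a finite error. -/
def almostStabilizer (G : Type*) [Group G] [MulAction G Ω] (A : Set Ω) : Subgroup G where
  carrier := {g | (symmDiff (g • A) A).Finite}
  one_mem' := by simp
  mul_mem' := fun {a b} ha hb => by
    refine finite_symmDiff_trans (C := a • A) ?_ ha
    rw [mul_smul, ← Set.smul_set_symmDiff]
    exact Set.Finite.smul_set hb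
  inv_mem' := fun {a} ha => by
    have : (a⁻¹ • symmDiff (a • A) A).Finite := Set.Finite.smul_set ha
    rw [Set.smul_set_symmDiff, inv_smul_smul, symmDiff_comm] at this
    exact this

theorem mem_almostStabilizer {A : Set Ω} {g : G} :
    g ∈ almostStabilizer G A ↔ (symmDiff (g • A) A).Finite := Iff.rfl

/-- The kernel of the action on the ends of a graph: the group of elements that preserve all cuts
up to a finite error. -/
def endKernel (G : Type*) [Group G] [MulAction G Ω] (Γ : SimpleGraph Ω) : Subgroup G :=
  ⨅ A : {A : Set Ω // IsCut Γ A}, almostStabilizer G (A : Set Ω)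

theorem mem_endKernel {g : G} :
    g ∈ endKernel G Γ ↔ ∀ A, IsCut Γ A → (symmDiff (g • A) A).Finite := by
  simp [endKernel, Subgroup.mem_iInf, mem_almostStabilizer]

theorem IsInvariantGraph.endKernel_normal (hΓ : IsInvariantGraph G Γ) :
    (endKernel G Γ).Normal := by
  refine ⟨fun n hn g => mem_endKernel.2 fun A hA => ?_⟩
  have h := (mem_endKernel.1 hn (g⁻¹ • A) (hΓ.isCut_smul _ hA)).smul_set (a := g)
  rwa [Set.smul_set_symmDiff, smul_inv_smul, ← mul_smul, ← mul_smul] at h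

theorem isOpen_of_fixing [TopologicalSpace G] [ContinuousMul G]
    (hopen : ∀ x : Ω, IsOpen {g : G | g • x = x}) {H : Subgroup G} {F : Set Ω} (hF : F.Finite)
    (hH : ∀ g : G, (∀ x ∈ F, g • x = x) → g ∈ H) : IsOpen (H : Set G) := by
  refine H.isOpen_of_mem_nhds (g := 1) ?_
  have h : (⋂ x ∈ F, {g : G | g • x = x}) ∈ nhds (1 : G) :=
    (Filter.biInter_mem hF).2 fun x _ => (hopen x).mem_nhds (one_smul _ _)
  filter_upwards [h] with g hg
  exact hH g fun x hx => Set.mem_iInter₂.1 hg x hx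

/-- Each almost stabiliser contains the pointwise stabiliser of a finite set enclosing the boundary,
so it is an open, hence closed, subgroup. -/
theorem IsInvariantGraph.isClosed_endKernel [TopologicalSpace G] [IsTopologicalGroup G]
    (hopen : ∀ x : Ω, IsOpen {g : G | g • x = x}) (hΓ : IsInvariantGraph G Γ) :
    IsClosed (endKernel G Γ : Set G) := by
  rw [endKernel, Subgroup.coe_iInf]
  refine isClosed_iInter fun A => Subgroup.isClosed_of_isOpen _ ?_
  obtain ⟨F, hF, hAF, hne, -⟩ := exists_finite_isConnSet hΓ.connected A.2
  refine isOpen_of_fixing hopen hF fun g hg => ?_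
  rw [mem_almostStabilizer, hΓ.smul_eq_of_fixing hne hAF hg]
  simp

/-- A group with finite orbits that is normalised by a transitive group fixes all ends. -/
theorem IsInvariantGraph.le_endKernel_of_finite (hΓ : IsInvariantGraph G Γ)
    (hfin : HasFiniteSuborbits G Ω) {B M : Subgroup G} (hB : IsTransOn B Ω)
    (hM : ∀ b ∈ B, ∀ m ∈ M, b * m * b⁻¹ ∈ M) {x : Ω} (hx : ((· • x) '' (M : Set G)).Finite) :
    M ≤ endKernel G Γ := by
  have key : ∀ m ∈ M, ∀ A, IsCut Γ A → (A \ m • A).Finite := by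
    intro m hm A hA
    -- For `y = b • x`, the point `m⁻¹ • y` lies in the `b`-translate of the finite orbit of `x`, so
    -- a point of `A \ m • A` makes `A` cut that translate.
    refine (hfin.finite_crossing hΓ hx hA x).subset ?_
    rintro y ⟨hyA, hy⟩
    obtain ⟨b, hb, rfl⟩ := hB x y
    refine ⟨b, ⟨x, ⟨1, M.one_mem, one_smul _ _⟩, (b⁻¹ * m⁻¹ * b) • x, ⟨_, ?_, rfl⟩, hyA, ?_⟩,
      rfl⟩
    · simpa using hM b⁻¹ (B.inv_mem hb) m⁻¹ (M.inv_mem hm)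
    · rw [Set.mem_smul_set_iff_inv_smul_mem] at hy
      rwa [← mul_smul, ← mul_assoc, ← mul_assoc, mul_inv_cancel, one_mul, mul_smul]
  intro m hm
  refine mem_endKernel.2 fun A hA => ?_
  rw [Set.symmDiff_def]
  refine Set.Finite.union ?_ (key m hm A hA)
  have h := (key m⁻¹ (M.inv_mem hm) A hA).smul_set (a := m)
  rwa [Set.smul_set_sdiff, smul_inv_smul] at h

/-- A group that fixes three distinct ends has finite orbits. -/
theorem IsInvariantGraph.finite_of_fixes_three (hΓ : IsInvariantGraph G Γ)
    (hfin : HasFiniteSuborbits G Ω) {M : Subgroup G} (U : Fin 3 → Ultrafilter Ω)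
    (A : Fin 3 → Set Ω) (hA : ∀ i, IsCut Γ (A i)) (hAU : ∀ i j, A i ∈ U j ↔ i = j)
    (hcover : ∀ x, ∃ i, x ∈ A i) (hM : ∀ m ∈ M, ∀ C, IsCut Γ C → ∀ i, C ∈ U i → m • C ∈ U i)
    (x : Ω) : ((· • x) '' (M : Set G)).Finite := by
  obtain ⟨F, hF, hAF, hne, hconn⟩ := exists_finite_isConnSet hΓ.connected
    (Set.finite_iUnion hA)
  replace hAF : ∀ i, cutVerts Γ (A i) ⊆ F := fun i => (Set.subset_iUnion _ i).trans hAF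
  refine (hfin.finite_smul hF hF x).subset ?_
  rintro _ ⟨m, hm, rfl⟩
  refine ⟨m, ?_, rfl⟩
  -- If `m • F` misses `F`, it lies in a single `A i`, and everything outside `A i` lies in one `m •
  -- A l`. Then the two ends other than the `i`-th both contain `A l`, which is impossible.
  by_contra hcon
  push Not at hcon
  have hdis : Disjoint (m • F) F := by
    rw [Set.disjoint_left]
    rintro _ ⟨f, hf, rfl⟩
    exact hcon f hf
  obtain ⟨f, hf⟩ := hne
  obtain ⟨i, hi⟩ := hcover (m • f)
  have hmF : m • F ⊆ A i := by
    rcases (hΓ.isConnSet_smul m hconn).subset_or (hdis.mono_right (hAF i)) with h | h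
    · exact h
    · exact absurd hi (h (Set.smul_mem_smul_set hf))
  obtain ⟨l, hl⟩ := hcover (m⁻¹ • f)
  have hsub : (A i)ᶜ ⊆ m • A l := by
    have hd : Disjoint ((A i)ᶜ ∪ F) (cutVerts Γ (m • A l)) := by
      rw [hΓ.cutVerts_smul]
      refine Disjoint.mono_right (Set.smul_set_mono (hAF l)) ?_
      rw [Set.disjoint_union_left]
      exact ⟨Set.disjoint_left.2 fun y hy hy' => hy (hmF hy'), hdis.symm⟩
    rcases (hconn.union_of_cutVerts_subset hΓ.connected ⟨f, hf⟩
      (by rw [cutVerts_compl]; exact hAF i)).subset_or hd with h | h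
    · exact Set.subset_union_left.trans h
    · exact absurd (Set.mem_smul_set_iff_inv_smul_mem.2 hl) (h (Or.inr hf))
  have key : ∀ j, j ≠ i → l = j := by
    intro j hj
    have h1 : (A i)ᶜ ∈ U j := Ultrafilter.compl_mem_iff_notMem.2 fun h => hj ((hAU i j).1 h).symm
    have h2 : m • A l ∈ U j := Filter.mem_of_superset h1 hsub
    have h3 := hM m⁻¹ (M.inv_mem hm) _ (hΓ.isCut_smul m (hA l)) j h2
    rw [inv_smul_smul] at h3
    exact (hAU l j).1 h3
  have h3 : ∀ i : Fin 3, i + 1 ≠ i ∧ i + 2 ≠ i ∧ i + 1 ≠ i + 2 := by decide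
  exact (h3 i).2.2 ((key _ (h3 i).1).symm.trans (key _ (h3 i).2.1))

theorem Ultrafilter.mem_map_smul {g : G} {U : Ultrafilter Ω} {A : Set Ω} :
    A ∈ U.map (g • ·) ↔ g⁻¹ • A ∈ U := by
  rw [Ultrafilter.mem_map, Set.preimage_smul]

/-- If an openly perfect group `B` permutes a set with at most two elements, and the stabilisers
are open, then it acts trivially. -/
theorem IsOpenlyPerfect.rel_of_three {B : Subgroup G} (hperf : IsOpenlyPerfect B Ω)
    (E : G → G → Prop) (hErefl : ∀ a, E a a) (hEsymm : ∀ {a b}, E a b → E b a)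
    (hEtrans : ∀ {a b c}, E a b → E b c → E a c)
    (hEmul : ∀ {a b} g, E a b → E (g * a) (g * b))
    (hthree : ∀ a ∈ B, ∀ b ∈ B, ∀ c ∈ B, E a b ∨ E a c ∨ E b c)
    (hopen : ∀ c, ¬ E 1 c → ∃ F : Set Ω, F.Finite ∧ ∀ b : G, (∀ x ∈ F, b • x = x) → ¬ E c b) :
    ∀ b ∈ B, E 1 b := by
  by_contra hcon
  push Not at hcon
  obtain ⟨c, hc, hcE⟩ := hcon
  have htwo : ∀ b ∈ B, ¬ E 1 b → E c b := fun b hb h1 => by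
    rcases hthree 1 B.one_mem c hc b hb with h | h | h
    · exact absurd h hcE
    · exact absurd h h1
    · exact h
  -- With at most two classes, each element either fixes or swaps them, and parities add.
  have hmul : ∀ a ∈ B, ∀ b ∈ B, (E 1 (a * b) ↔ (E 1 a ↔ E 1 b)) := by
    intro a ha b hb
    by_cases h1 : E 1 b
    · have h2 := hEmul a h1
      rw [mul_one] at h2
      exact ⟨fun h => iff_of_true (hEtrans h (hEsymm h2)) h1,
        fun h => hEtrans (h.2 h1) h2⟩
    · have h2 : ¬ E a (a * b) := fun h => h1 (by
        have := hEmul a⁻¹ h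
        rwa [inv_mul_cancel, inv_mul_cancel_left] at this)
      by_cases h3 : E 1 a
      · simp only [h3, h1, iff_false, not_true]
        exact fun h => h2 (hEtrans (hEsymm h3) h)
      · simp only [h3, h1, iff_true]
        by_contra h4
        exact h2 (hEtrans (hEsymm (htwo a ha h3)) (htwo _ (B.mul_mem ha hb) h4))
  have hinv : ∀ a ∈ B, (E 1 a⁻¹ ↔ E 1 a) := fun a ha => by
    have := hmul a ha a⁻¹ (B.inv_mem ha)
    rw [mul_inv_cancel] at this
    exact ((iff_true_left (hErefl 1)).1 this).symm
  let H : Subgroup G :=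
    { carrier := {b | b ∈ B ∧ E 1 b}
      one_mem' := ⟨B.one_mem, hErefl 1⟩
      mul_mem' := fun {a b} ha hb =>
        ⟨B.mul_mem ha.1 hb.1, (hmul a ha.1 b hb.1).2 (iff_of_true ha.2 hb.2)⟩
      inv_mem' := fun {a} ha => ⟨B.inv_mem ha.1, (hinv a ha.1).2 ha.2⟩ }
  have hBH : B ≤ H := by
    refine hperf H (fun b hb => hb.1) (fun a ha b hb => ⟨?_, ?_⟩) ?_
    · exact B.mul_mem (B.mul_mem (B.mul_mem ha hb) (B.inv_mem ha)) (B.inv_mem hb)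
    · rw [hmul _ (B.mul_mem (B.mul_mem ha hb) (B.inv_mem ha)) _ (B.inv_mem hb),
        hmul _ (B.mul_mem ha hb) _ (B.inv_mem ha), hmul a ha b hb, hinv a ha, hinv b hb]
      tauto
    · obtain ⟨F, hF, h⟩ := hopen c hcE
      exact ⟨F, hF, fun b hb hbF => ⟨hb, by_contra fun h1 => h b hbF (htwo b hb h1)⟩⟩
  exact hcE (hBH hc).2

/-- Two commuting nontrivial subgroups normalised by `B` cannot coexist with more than one end, if
`B` is openly perfect, transitive and contained in all nontrivial closed normal subgroups. -/
theorem IsInvariantGraph.false_of_commuting [TopologicalSpace G] [IsTopologicalGroup G]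
    [Infinite Ω] (hopen : ∀ x : Ω, IsOpen {g : G | g • x = x}) (hΓ : IsInvariantGraph G Γ)
    (hfin : HasFiniteSuborbits G Ω) {B : Subgroup G} (hB : IsTransOn B Ω)
    (hperf : IsOpenlyPerfect B Ω)
    (hmin : ∀ N : Subgroup G, N.Normal → N ≠ ⊥ → IsClosed (N : Set G) → B ≤ N)
    {A₀ : Set Ω} (hA₀ : IsCut Γ A₀) (hinf : A₀.Infinite) (hinf' : A₀ᶜ.Infinite)
    {M₁ M₂ : Subgroup G} (h₁ : M₁ ≠ ⊥) (h₂ : M₂ ≠ ⊥)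
    (hn₁ : ∀ b ∈ B, ∀ m ∈ M₁, b * m * b⁻¹ ∈ M₁) (hn₂ : ∀ b ∈ B, ∀ m ∈ M₂, b * m * b⁻¹ ∈ M₂)
    (hcomm : ∀ a ∈ M₁, ∀ b ∈ M₂, a * b = b * a) : False := by
  obtain ⟨x⟩ := hΓ.connected.nonempty
  have hX := hΓ.false_of_fixed_end hfin hB hperf hA₀ hinf hinf'
  have hBE : ¬ B ≤ endKernel G Γ := fun h => by
    -- Elements of the kernel change cuts only by finite sets, so they fix every end; any
    -- nonprincipal ultrafilter will do.
    refine hX (Filter.hyperfilter Ω) fun b hb A hA hAU => ?_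
    have h1 := mem_endKernel.1 (h hb) A hA
    by_contra hcon
    have h2 : A \ b • A ∈ Filter.hyperfilter Ω :=
      Filter.inter_mem hAU (Ultrafilter.compl_mem_iff_notMem.2 hcon)
    refine Filter.notMem_hyperfilter_of_finite (h1.subset ?_) h2
    rw [Set.symmDiff_def]
    exact Set.subset_union_right
  have horb : ∀ M : Subgroup G, M ≠ ⊥ → (∀ b ∈ B, ∀ m ∈ M, b * m * b⁻¹ ∈ M) →
      ((· • x) '' (M : Set G)).Infinite := fun M hM hnM hf => by
    have hle := hΓ.le_endKernel_of_finite hfin hB hnM hf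
    refine hBE (hmin _ hΓ.endKernel_normal (fun h => hM ?_) (hΓ.isClosed_endKernel hopen))
    rw [h] at hle
    exact le_bot_iff.1 hle
  have hinf₁ := horb M₁ h₁ hn₁
  have hinf₂ := horb M₂ h₂ hn₂
  -- an end that is fixed by `M₂`
  obtain ⟨U, hUcof, hUM⟩ : ∃ U : Ultrafilter Ω, (U : Filter Ω) ≤ Filter.cofinite ∧
      (· • x) '' (M₁ : Set G) ∈ U := by
    have : (Filter.cofinite ⊓ Filter.principal ((· • x) '' (M₁ : Set G))).NeBot :=
      Filter.cofinite_inf_principal_neBot_iff.2 hinf₁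
    have h := Ultrafilter.of_le (Filter.cofinite ⊓ Filter.principal ((· • x) '' (M₁ : Set G)))
    exact ⟨_, h.trans inf_le_left, h.trans inf_le_right (Filter.mem_principal_self _)⟩
  -- For `n` in `M₁`, commutation gives `m⁻¹ • n • x = n • m⁻¹ • x`. So where membership changes,
  -- `A` separates the `n`-translate of the fixed pair `x`, `m⁻¹ • x`, which happens at finitely
  -- many `n • x`.
  have hfix : ∀ m ∈ M₂, ∀ A, IsCut Γ A → A ∈ U → m • A ∈ U := by
    intro m hm A hA hAU
    by_contra hcon
    have h1 : (· • x) '' (M₁ : Set G) ∩ (A ∩ (m • A)ᶜ) ∈ U :=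
      Filter.inter_mem hUM (Filter.inter_mem hAU (Ultrafilter.compl_mem_iff_notMem.2 hcon))
    have h2 : ((· • x) '' (M₁ : Set G) ∩ (A ∩ (m • A)ᶜ)).Finite := by
      refine (hfin.finite_crossing hΓ (Set.toFinite {x, m⁻¹ • x}) hA x).subset ?_
      rintro _ ⟨⟨n, hn, rfl⟩, hnA, hnm⟩
      refine ⟨n, ⟨x, by simp, m⁻¹ • x, by simp, hnA, ?_⟩, rfl⟩
      intro h
      refine hnm (Set.mem_smul_set_iff_inv_smul_mem.2 ?_)
      rwa [← mul_smul, hcomm n hn m⁻¹ (M₂.inv_mem hm), mul_smul] at h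
    have h3 : ((· • x) '' (M₁ : Set G) ∩ (A ∩ (m • A)ᶜ))ᶜ ∈ U := hUcof h2.compl_mem_cofinite
    exact Ultrafilter.compl_mem_iff_notMem.1 h3 h1
  have hfixb : ∀ b ∈ B, ∀ m ∈ M₂, ∀ A, IsCut Γ A → A ∈ U.map (b • ·) →
      m • A ∈ U.map (b • ·) := by
    intro b hb m hm A hA hAU
    rw [Ultrafilter.mem_map_smul] at hAU ⊢
    have h := hfix (b⁻¹ * m * b) (by simpa using hn₂ b⁻¹ (B.inv_mem hb) m hm) _
      (hΓ.isCut_smul _ hA) hAU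
    rwa [← mul_smul, mul_assoc, mul_inv_cancel, mul_one, mul_smul] at h
  -- the orbit of this end has at most two elements
  let E : G → G → Prop := fun a b => ∀ A, IsCut Γ A → (a⁻¹ • A ∈ U ↔ b⁻¹ • A ∈ U)
  have hsep : ∀ a b, ¬ E a b → ∃ A, IsCut Γ A ∧ a⁻¹ • A ∈ U ∧ b⁻¹ • A ∉ U := by
    intro a b hab
    simp only [E, not_forall] at hab
    obtain ⟨A, hA, h⟩ := hab
    by_cases h1 : a⁻¹ • A ∈ U
    · exact ⟨A, hA, h1, fun h2 => h (by tauto)⟩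
    · refine ⟨Aᶜ, hA.compl, ?_, ?_⟩ <;>
        rw [Set.smul_set_compl, Ultrafilter.compl_mem_iff_notMem] <;> tauto
  have hthree : ∀ a ∈ B, ∀ b ∈ B, ∀ c ∈ B, E a b ∨ E a c ∨ E b c := by
    intro a ha b hb c hc
    by_contra hcon
    push Not at hcon
    obtain ⟨hab, hac, hbc⟩ := hcon
    obtain ⟨C, hC, hCa, hCb⟩ := hsep a b hab
    obtain ⟨D, hD, hDa, hDc⟩ := hsep a c hac
    obtain ⟨K, hK, hKb, hKc⟩ := hsep b c hbc
    refine hinf₂ (hΓ.finite_of_fixes_three hfin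
      ![U.map (a • ·), U.map (b • ·), U.map (c • ·)]
      ![C ∩ D, Cᶜ ∩ K, (C ∩ D)ᶜ ∩ (Cᶜ ∩ K)ᶜ] ?_ ?_ ?_ ?_ x)
    · intro i
      fin_cases i
      · exact hC.inter hD
      · exact hC.compl.inter hK
      · exact (hC.inter hD).compl.inter (hC.compl.inter hK).compl
    · have e : ∀ (X Y : Set Ω) (g : G), X ∩ Y ∈ U.map (g • ·) ↔
          X ∈ U.map (g • ·) ∧ Y ∈ U.map (g • ·) := fun X Y g => Filter.inter_mem_iff
      have e' : ∀ (X : Set Ω) (g : G), Xᶜ ∈ U.map (g • ·) ↔ X ∉ U.map (g • ·) :=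
        fun X g => Ultrafilter.compl_mem_iff_notMem
      rw [← Ultrafilter.mem_map_smul] at hCa hCb hDa hDc hKb hKc
      intro i j
      fin_cases i <;> fin_cases j <;> simp [e, e', hCa, hCb, hDa, hDc, hKb, hKc]
    · intro y
      by_cases h1 : y ∈ C ∩ D
      · exact ⟨0, h1⟩
      · by_cases h2 : y ∈ Cᶜ ∩ K
        · exact ⟨1, h2⟩
        · exact ⟨2, h1, h2⟩
    · intro m hm A hA i
      fin_cases i
      · exact hfixb a ha m hm A hA
      · exact hfixb b hb m hm A hA
      · exact hfixb c hc m hm A hA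
  have hEsymm : ∀ {a b}, E a b → E b a := fun h A hA => (h A hA).symm
  have hEtrans : ∀ {a b c}, E a b → E b c → E a c := fun h h' A hA => (h A hA).trans (h' A hA)
  have hEmul : ∀ {a b} g, E a b → E (g * a) (g * b) := fun {a b} g h A hA => by
    have := h (g⁻¹ • A) (hΓ.isCut_smul _ hA)
    rwa [← mul_smul, ← mul_smul, ← mul_inv_rev, ← mul_inv_rev] at this
  have hErefl : ∀ a, E a a := fun a A _ => Iff.rfl
  have hall : ∀ b ∈ B, E 1 b := by
    refine hperf.rel_of_three E hErefl hEsymm hEtrans hEmul hthree fun c hc => ?_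
    obtain ⟨A, hA, hA1, hAc⟩ := hsep 1 c hc
    obtain ⟨F, hF, hAF, hne, -⟩ := exists_finite_isConnSet hΓ.connected hA
    refine ⟨F, hF, fun b hbF h => hAc ((h A hA).2 ?_)⟩
    rw [inv_one, one_smul] at hA1
    rwa [inv_smul_eq_iff.2 (hΓ.smul_eq_of_fixing hne hAF hbF).symm]
  refine hX U fun b hb A hA hAU => ?_
  have h := (hall b⁻¹ (B.inv_mem hb) A hA).1 (by rwa [inv_one, one_smul])
  rwa [inv_inv] at h

end Ends

/-! ### Conjugates of a subgroup, semiregular subgroups, and density of commutators. -/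

section Conjugates

variable {G Ω : Type*} [Group G]

/-- The subgroup `g M g⁻¹`. -/
def conjSubgroup (g : G) (M : Subgroup G) : Subgroup G :=
  M.comap (MulAut.conj g⁻¹).toMonoidHom

theorem mem_conjSubgroup {g m : G} {M : Subgroup G} :
    m ∈ conjSubgroup g M ↔ g⁻¹ * m * g ∈ M := by
  simp [conjSubgroup, Subgroup.mem_comap]

theorem conjSubgroup_normalised {B M : Subgroup G} (hB : B.Normal)
    (hM : ∀ b ∈ B, ∀ m ∈ M, b * m * b⁻¹ ∈ M) (g : G) :
    ∀ b ∈ B, ∀ m ∈ conjSubgroup g M, b * m * b⁻¹ ∈ conjSubgroup g M := by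
  intro b hb m hm
  rw [mem_conjSubgroup] at hm ⊢
  have h := hM (g⁻¹ * b * g) (by simpa using hB.conj_mem b hb g⁻¹) _ hm
  convert h using 1
  group

theorem conjSubgroup_eq_bot {M : Subgroup G} {g : G} (h : conjSubgroup g M = ⊥) : M = ⊥ := by
  rw [eq_bot_iff]
  intro m hm
  have h1 : g * m * g⁻¹ ∈ conjSubgroup g M := by
    rw [mem_conjSubgroup]
    convert hm using 1
    group
  rw [h, Subgroup.mem_bot, conj_eq_one_iff] at h1
  exact h1

theorem isClosed_conjSubgroup [TopologicalSpace G] [IsTopologicalGroup G] {M : Subgroup G}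
    (hM : IsClosed (M : Set G)) (g : G) : IsClosed (conjSubgroup g M : Set G) := by
  have : (conjSubgroup g M : Set G) = (fun m => g⁻¹ * m * g) ⁻¹' (M : Set G) := by
    ext m
    exact mem_conjSubgroup
  rw [this]
  exact hM.preimage (by fun_prop)

variable [MulAction G Ω]

/-- A semiregular subgroup of `B`, normalised by `B`, forces the point stabilisers in `B` to be
finite. -/
theorem IsInvariantGraph.finite_stabilizer_of_semiregular [FaithfulSMul G Ω]
    {Γ : SimpleGraph Ω} (hΓ : IsInvariantGraph G Γ)
    (hfin : HasFiniteSuborbits G Ω) (hprim : ∀ N : Subgroup G, N.Normal → N ≠ ⊥ → IsTransOn N Ω)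
    {B M : Subgroup G} (hBn : B.Normal) (hMB : M ≤ B) (hM : M ≠ ⊥)
    (hMn : ∀ b ∈ B, ∀ m ∈ M, b * m * b⁻¹ ∈ M) (hreg : ∀ m ∈ M, ∀ x : Ω, m • x = x → m = 1)
    (x : Ω) : {g : G | g • x = x}.Finite := by
  -- the elements of `B` with small conjugacy classes
  let T : Subgroup G :=
    { carrier := {q | q ∈ B ∧ ∀ y z : Ω, ((fun u => u * q * u⁻¹) '' {u | u ∈ B ∧ u • y = z}).Finite}
      one_mem' := ⟨B.one_mem, fun y z => (Set.finite_singleton 1).subset (by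
        rintro _ ⟨u, -, rfl⟩
        simp)⟩
      mul_mem' := fun {a b} ha hb => ⟨B.mul_mem ha.1 hb.1, fun y z => by
        refine (Set.Finite.image2 (fun p q => p * q) (ha.2 y z) (hb.2 y z)).subset ?_
        rintro _ ⟨u, hu, rfl⟩
        exact ⟨_, ⟨u, hu, rfl⟩, _, ⟨u, hu, rfl⟩, by group⟩⟩
      inv_mem' := fun {a} ha => ⟨B.inv_mem ha.1, fun y z => by
        refine ((ha.2 y z).image fun p => p⁻¹).subset ?_
        rintro _ ⟨u, hu, rfl⟩
        exact ⟨_, ⟨u, hu, rfl⟩, by group⟩⟩ }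
  have hTn : T.Normal := ⟨fun q hq g => ⟨hBn.conj_mem q hq.1 g, fun y z => by
    refine ((hq.2 (g⁻¹ • y) (g⁻¹ • z)).image fun p => g * p * g⁻¹).subset ?_
    rintro _ ⟨u, ⟨hu, rfl⟩, rfl⟩
    refine ⟨_, ⟨g⁻¹ * u * g, ⟨by simpa using hBn.conj_mem u hu g⁻¹, ?_⟩, rfl⟩, by group⟩
    simp [mul_smul]⟩⟩
  have hMT : M ≤ T := fun q hq => ⟨hMB hq, fun y z => by
    -- By semiregularity a conjugate of `q` is determined by its value at `z = u • y`, namely `u • q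
    -- • y`, which has finitely many possibilities.
    refine Set.Finite.of_finite_image (f := fun g : G => g • z) ?_ ?_
    · refine (hfin y (q • y) z).subset ?_
      rintro _ ⟨_, ⟨u, ⟨hu, rfl⟩, rfl⟩, rfl⟩
      exact ⟨u, rfl, by simp [mul_smul]⟩
    · rintro _ ⟨u, hu, rfl⟩ _ ⟨v, hv, rfl⟩ (he : (u * q * u⁻¹) • z = (v * q * v⁻¹) • z)
      have h := hreg _ (M.mul_mem (M.inv_mem (hMn v hv.1 q hq)) (hMn u hu.1 q hq)) z
        (by rw [mul_smul, he, inv_smul_smul])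
      exact (inv_mul_eq_one.1 h).symm⟩
  have hTb : T ≠ ⊥ := fun h => hM (le_bot_iff.1 (h ▸ hMT))
  obtain ⟨S, hST, hS⟩ := hΓ.exists_finset_isTransOn (hprim T hTn hTb)
  have hfinite : ∀ U : Set G, (∀ u ∈ U, u • x = x) →
      (∀ s ∈ S, ((fun u => u * s * u⁻¹) '' U).Finite) → U.Finite := by
    intro U hU hUS
    by_contra hinf
    obtain ⟨u, hu, v, hv, huv, hc⟩ := exists_ne_commute hinf S hUS
    refine huv (inv_mul_eq_one.1 (hS.eq_one_of_commute_closure hc (x := x) ?_))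
    rw [mul_smul, hU v hv, inv_smul_eq_iff, hU u hu]
  have hBx : {u | u ∈ B ∧ u • x = x}.Finite :=
    hfinite _ (fun u hu => hu.2) fun s hs => (hST hs).2 x x
  -- From the stabiliser in `B` to that in `G`: a conjugate of `s` lies in `B` and maps `x` into a
  -- finite suborbit, so it lies in finitely many cosets of the finite stabiliser in `B`.
  refine hfinite _ (fun u hu => hu) fun s hs => ?_
  have hBw : ∀ w, {u | u ∈ B ∧ u • x = w}.Finite := by
    intro w
    by_cases hw : ∃ c ∈ B, c • x = w
    · obtain ⟨c, hc, rfl⟩ := hw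
      refine (hBx.image fun u => c * u).subset ?_
      rintro u ⟨hu, hux⟩
      exact ⟨c⁻¹ * u, ⟨B.mul_mem (B.inv_mem hc) hu, by rw [mul_smul, hux, inv_smul_smul]⟩,
        mul_inv_cancel_left _ _⟩
    · refine Set.finite_empty.subset ?_
      rintro u ⟨hu, hux⟩
      exact hw ⟨u, hu, hux⟩
  refine ((hfin x (s • x) x).biUnion fun w _ => hBw w).subset ?_
  rintro _ ⟨u, hu, rfl⟩
  replace hu : u • x = x := hu
  refine Set.mem_biUnion (x := u • s • x) ⟨u, hu, rfl⟩
    ⟨hBn.conj_mem s (hST hs).1 u, ?_⟩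
  rw [mul_smul, mul_smul, inv_smul_eq_iff.2 hu.symm]

/-- A nonabelian normal subgroup contained in all nontrivial closed normal subgroups is openly
perfect. -/
theorem isOpenlyPerfect_of_minimal [TopologicalSpace G] [IsTopologicalGroup G]
    (hopen : ∀ x : Ω, IsOpen {g : G | g • x = x})
    {B : Subgroup G} (hBn : B.Normal)
    (hmin : ∀ N : Subgroup G, N.Normal → N ≠ ⊥ → IsClosed (N : Set G) → B ≤ N)
    (hab : ¬ ∀ a ∈ B, ∀ b ∈ B, a * b = b * a) : IsOpenlyPerfect B Ω := by
  intro H hHB hcomm ⟨F, hF, hFH⟩ g hg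
  have hle : ⁅B, B⁆ ≤ H := Subgroup.commutator_le.2 hcomm
  have hne : ⁅B, B⁆ ≠ ⊥ := fun h => hab fun a ha b hb => by
    have h1 := Subgroup.commutator_mem_commutator ha hb
    rw [h, Subgroup.mem_bot, commutatorElement_eq_one_iff_mul_comm] at h1
    exact h1
  have h1 : B ≤ ⁅B, B⁆.topologicalClosure := by
    refine hmin _ (Subgroup.is_normal_topologicalClosure _) (fun h => hne ?_)
      (Subgroup.isClosed_topologicalClosure _)
    exact le_bot_iff.1 (h ▸ Subgroup.le_topologicalClosure _)
  have h2 : IsOpen (⋂ x ∈ F, {k : G | k • x = x}) := hF.isOpen_biInter fun x _ => hopen x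
  -- [B, B] is dense in B, so it meets every neighbourhood of `g`; being an open overgroup of [B, B]
  -- in B, `H` then contains `g`.
  obtain ⟨c, hc, hcB⟩ := mem_closure_iff.1 (h1 hg)
    ((fun k => g⁻¹ * k) ⁻¹' ⋂ x ∈ F, {k : G | k • x = x})
    (h2.preimage (continuous_const_mul _))
    (Set.mem_iInter₂.2 fun x _ => by simp)
  have h3 : g⁻¹ * c ∈ H := hFH _ (B.mul_mem (B.inv_mem hg) (hHB (hle hcB)))
    fun x hx => Set.mem_iInter₂.1 hc x hx
  have h4 := H.mul_mem (hle hcB) (H.inv_mem h3)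
  rwa [mul_inv_rev, inv_inv, mul_inv_cancel_left] at h4

end Conjugates

/-! ### The closed monolith and its closed normal subgroups. -/

section Monolith

variable {G Ω : Type*} [Group G] [TopologicalSpace G]

/-- The intersection of all nontrivial closed normal subgroups. -/
def closedMonolith (G : Type*) [Group G] [TopologicalSpace G] : Subgroup G :=
  ⨅ N : {N : Subgroup G // N.Normal ∧ N ≠ ⊥ ∧ IsClosed (N : Set G)}, (N : Subgroup G)

theorem closedMonolith_le {N : Subgroup G} (hn : N.Normal) (hb : N ≠ ⊥)
    (hc : IsClosed (N : Set G)) : closedMonolith G ≤ N :=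
  iInf_le (fun N : {N : Subgroup G // N.Normal ∧ N ≠ ⊥ ∧ IsClosed (N : Set G)} =>
    (N : Subgroup G)) ⟨N, hn, hb, hc⟩

theorem closedMonolith_normal : (closedMonolith G).Normal :=
  Subgroup.normal_iInf_normal fun N => N.2.1

theorem isClosed_closedMonolith : IsClosed (closedMonolith G : Set G) := by
  rw [closedMonolith, Subgroup.coe_iInf]
  exact isClosed_iInter fun N => N.2.2.2

variable [MulAction G Ω] [Infinite Ω]

/-- Finite intersections of nontrivial closed normal subgroups are nontrivial, hence transitive, so
they meet the compact set `{g | g • x = y}`. For x ≠ y, compactness yields a common nontrivial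
element. -/
theorem closedMonolith_ne_bot (hcpt : ∀ x y : Ω, IsCompact {g : G | g • x = y})
    (hG : IsTransOn (⊤ : Subgroup G) Ω)
    (hinf : ∀ N₁ N₂ : Subgroup G, N₁.Normal → N₂.Normal → N₁ ≠ ⊥ → N₂ ≠ ⊥ → N₁ ⊓ N₂ ≠ ⊥)
    (hprim : ∀ N : Subgroup G, N.Normal → N ≠ ⊥ → IsTransOn N Ω) : closedMonolith G ≠ ⊥ := by
  classical
  obtain ⟨x, y, hxy⟩ := exists_pair_ne Ω
  have htop : (⊤ : Subgroup G) ≠ ⊥ := fun h => by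
    obtain ⟨g, hg, hgx⟩ := hG x y
    rw [h, Subgroup.mem_bot] at hg
    rw [hg, one_smul] at hgx
    exact hxy hgx
  let ι := {N : Subgroup G // N.Normal ∧ N ≠ ⊥ ∧ IsClosed (N : Set G)}
  have hfinite : ∀ u : Finset ι, (⨅ i ∈ u, (i : Subgroup G)).Normal ∧
      (⨅ i ∈ u, (i : Subgroup G)) ≠ ⊥ := by
    intro u
    induction u using Finset.induction_on with
    | empty => simpa using htop
    | insert i u _ ih =>
      rw [Finset.iInf_insert]
      have h1 := i.2.1
      have h2 := ih.1
      exact ⟨inferInstance, hinf _ _ i.2.1 ih.1 i.2.2.1 ih.2⟩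
  obtain ⟨g, hg, hgN⟩ := (hcpt x y).inter_iInter_nonempty (fun i : ι => ((i : Subgroup G) : Set G))
    (fun i => i.2.2.2) (fun u => by
      obtain ⟨g, hg, hgx⟩ := hprim _ (hfinite u).1 (hfinite u).2 x y
      refine ⟨g, hgx, ?_⟩
      simpa [Subgroup.mem_iInf] using hg)
  intro h
  have hg' : g ∈ closedMonolith G := Subgroup.mem_iInf.2 fun i => Set.mem_iInter.1 hgN i
  rw [h, Subgroup.mem_bot] at hg'
  have : g • x = y := hg
  rw [hg', one_smul] at this
  exact hxy this

variable [IsTopologicalGroup G] [FaithfulSMul G Ω] {Γ : SimpleGraph Ω}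

/-- If nontrivial subgroups of `B` normalised by `B` never commute, then `B` has no proper
nontrivial closed subgroups normalised by `B`. -/
theorem IsInvariantGraph.le_of_normalised (hopen : ∀ x : Ω, IsOpen {g : G | g • x = x})
    (hcpt : ∀ x y : Ω, IsCompact {g : G | g • x = y}) (hΓ : IsInvariantGraph G Γ)
    (hfin : HasFiniteSuborbits G Ω) (hprim : ∀ N : Subgroup G, N.Normal → N ≠ ⊥ → IsTransOn N Ω)
    {B : Subgroup G} (hBn : B.Normal) (hB : B ≠ ⊥)
    (hmin : ∀ N : Subgroup G, N.Normal → N ≠ ⊥ → IsClosed (N : Set G) → B ≤ N)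
    (hcomm : ∀ M₁ M₂ : Subgroup G, M₁ ≠ ⊥ → M₂ ≠ ⊥ → (∀ b ∈ B, ∀ m ∈ M₁, b * m * b⁻¹ ∈ M₁) →
      (∀ b ∈ B, ∀ m ∈ M₂, b * m * b⁻¹ ∈ M₂) → ¬ ∀ a ∈ M₁, ∀ b ∈ M₂, a * b = b * a)
    {M : Subgroup G} (hMB : M ≤ B) (hMc : IsClosed (M : Set G)) (hM : M ≠ ⊥)
    (hMn : ∀ b ∈ B, ∀ m ∈ M, b * m * b⁻¹ ∈ M) : B ≤ M := by
  classical
  by_contra hlt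
  have hBt := hprim B hBn hB
  -- the core of `M` is trivial
  have hcore : ∀ m, (∀ g, m ∈ conjSubgroup g M) → m = 1 := by
    have hcl : IsClosed ((⨅ g, conjSubgroup g M : Subgroup G) : Set G) := by
      rw [Subgroup.coe_iInf]
      exact isClosed_iInter fun g => isClosed_conjSubgroup hMc g
    have hn : (⨅ g, conjSubgroup g M).Normal := ⟨fun m hm k => by
      rw [Subgroup.mem_iInf] at hm ⊢
      intro g
      have := hm (k⁻¹ * g)
      rw [mem_conjSubgroup] at this ⊢
      convert this using 1
      group⟩
    have hle : ⨅ g, conjSubgroup g M ≤ M := fun m hm => by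
      have := Subgroup.mem_iInf.1 hm 1
      simpa [mem_conjSubgroup] using this
    have hbot : ⨅ g, conjSubgroup g M = ⊥ := by
      by_contra hne
      exact hlt ((hmin _ hn hne hcl).trans hle)
    intro m hm
    have : m ∈ ⨅ g, conjSubgroup g M := Subgroup.mem_iInf.2 hm
    rwa [hbot, Subgroup.mem_bot] at this
  -- finite intersections of conjugates of `M` are nontrivial
  let Q : Finset G → Subgroup G := fun u => B ⊓ ⨅ g ∈ u, conjSubgroup g M
  have hQmem : ∀ u m, m ∈ Q u ↔ m ∈ B ∧ ∀ g ∈ u, m ∈ conjSubgroup g M := fun u m => by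
    simp [Q, Subgroup.mem_inf, Subgroup.mem_iInf]
  have hQn : ∀ u, ∀ b ∈ B, ∀ m ∈ Q u, b * m * b⁻¹ ∈ Q u := by
    intro u b hb m hm
    rw [hQmem] at hm ⊢
    exact ⟨hBn.conj_mem m hm.1 b,
      fun g hg => conjSubgroup_normalised hBn hMn g b hb m (hm.2 g hg)⟩
  -- If adding one conjugate made the intersection trivial, that conjugate and `Q u` would contain
  -- their mutual commutators and so commute, against `hcomm`.
  have hQ : ∀ u, Q u ≠ ⊥ := by
    intro u
    induction u using Finset.induction_on with
    | empty => simpa [Q] using hB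
    | insert k u _ ih =>
      intro hbot
      have hkB : conjSubgroup k M ≤ B := fun m hm => by
        rw [mem_conjSubgroup] at hm
        have := hBn.conj_mem _ (hMB hm) k
        convert this using 1
        group
      have hkn := conjSubgroup_normalised hBn hMn k
      refine hcomm (conjSubgroup k M) (Q u) (fun h => hM (conjSubgroup_eq_bot h)) ih hkn (hQn u) ?_
      intro a ha b hb
      have hbB : b ∈ B := ((hQmem u b).1 hb).1
      have h1 : a * b * a⁻¹ * b⁻¹ ∈ conjSubgroup k M := by
        have := (conjSubgroup k M).mul_mem ha (hkn b hbB a⁻¹ (Subgroup.inv_mem _ ha))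
        convert this using 1
        group
      have h2 : a * b * a⁻¹ * b⁻¹ ∈ Q u :=
        (Q u).mul_mem (hQn u a (hkB ha) b hb) (Subgroup.inv_mem _ hb)
      have h3 : a * b * a⁻¹ * b⁻¹ ∈ Q (insert k u) := by
        rw [hQmem] at h2 ⊢
        refine ⟨h2.1, fun g hg => ?_⟩
        rcases Finset.mem_insert.1 hg with rfl | hg
        · exact h1
        · exact h2.2 g hg
      rw [hbot, Subgroup.mem_bot] at h3
      exact commutatorElement_eq_one_iff_mul_comm.1 h3
  -- one of them is semiregular
  obtain ⟨x⟩ := hΓ.connected.nonempty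
  obtain ⟨u, hu⟩ : ∃ u : Finset G, ∀ m ∈ Q u, m • x = x → ∀ y, Γ.Adj x y → m • y = y := by
    by_contra hcon
    push Not at hcon
    -- The elements fixing `x` and moving some neighbour form a compact set. If every `Q u` met it,
    -- so would the core of `M`, which is trivial.
    have hKc : IsCompact ({g : G | g • x = x} ∩ ⋃ y ∈ Γ.neighborSet x, {g : G | g • y = y}ᶜ) :=
      (hcpt x x).inter_right ((hΓ.locallyFinite x).isClosed_biUnion fun y _ =>
        (hopen y).isClosed_compl)
    obtain ⟨g, ⟨-, hg⟩, hgM⟩ := hKc.inter_iInter_nonempty (fun g => (conjSubgroup g M : Set G))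
      (isClosed_conjSubgroup hMc)
      (fun u => by
        obtain ⟨m, hm, hmx, y, hy, hmy⟩ := hcon u
        exact ⟨m, ⟨hmx, Set.mem_biUnion hy hmy⟩,
          Set.mem_iInter₂.2 fun g hg => ((hQmem u m).1 hm).2 g hg⟩)
    rw [hcore g fun k => Set.mem_iInter.1 hgM k] at hg
    simp at hg
  have hreg : ∀ m ∈ Q u, ∀ y : Ω, m • y = y → m = 1 := by
    intro m hm y hy
    refine FaithfulSMul.eq_of_smul_eq_smul (α := Ω) fun z => ?_
    rw [one_smul]
    refine isConnSet_univ hΓ.connected {z | m • z = z} ?_ y trivial z trivial hy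
    intro v _ w _ hvw hv
    obtain ⟨b, hb, rfl⟩ := hBt x v
    have h1 := hu (b⁻¹ * m * b) (by simpa using hQn u b⁻¹ (B.inv_mem hb) m hm)
      (by rw [mul_smul, mul_smul, show m • b • x = b • x from hv, inv_smul_smul])
      (b⁻¹ • w) (by simpa using hΓ.adj_smul b⁻¹ hvw)
    rw [mul_smul, smul_inv_smul, mul_smul] at h1
    exact smul_left_cancel _ h1
  -- hence there are finitely many conjugates
  have hGx := hΓ.finite_stabilizer_of_semiregular hfin hprim hBn (fun m hm => ((hQmem u m).1 hm).1)
    (hQ u) (hQn u) hreg x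
  refine hQ hGx.toFinset ((Subgroup.eq_bot_iff_forall _).2 fun m hm => hcore m fun g => ?_)
  -- G = B·Gₓ and B normalises M, so the conjugates by the finite stabiliser Gₓ are all the
  -- conjugates.
  obtain ⟨b, hb, hbx⟩ := hBt x (g • x)
  have hk : m ∈ conjSubgroup (b⁻¹ * g) M := by
    refine ((hQmem _ m).1 hm).2 _ (hGx.mem_toFinset.2 ?_)
    show (b⁻¹ * g) • x = x
    rw [mul_smul, ← hbx, inv_smul_smul]
  have h2 : b⁻¹ * m * b⁻¹⁻¹ ∈ conjSubgroup (b⁻¹ * g) M :=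
    conjSubgroup_normalised hBn hMn _ _ (B.inv_mem hb) m hk
  rw [mem_conjSubgroup] at h2 ⊢
  convert h2 using 1
  group

end Monolith

/-! ### The permutation topology: group structure, compactness, and orbital graphs. -/

section PermutationTopology

theorem continuous_perm_iff {X Ω : Type*} [TopologicalSpace X] {f : X → Equiv.Perm Ω} :
    Continuous f ↔ ∀ x y : Ω, IsOpen {a | f a x = y} := by
  let _ : TopologicalSpace Ω := ⊥
  have _ : DiscreteTopology Ω := ⟨rfl⟩
  rw [continuous_induced_rng, continuous_pi_iff]
  refine forall_congr' fun x => ?_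
  rw [continuous_discrete_rng]
  exact Iff.rfl

theorem isOpen_perm_apply_eq {Ω : Type*} (x y : Ω) : IsOpen {g : Equiv.Perm Ω | g x = y} :=
  continuous_perm_iff.1 continuous_id x y

instance permutationTopology_isTopologicalGroup (Ω : Type*) :
    IsTopologicalGroup (Equiv.Perm Ω) where
  continuous_mul := continuous_perm_iff.2 fun x y => by
    have : {p : Equiv.Perm Ω × Equiv.Perm Ω | (p.1 * p.2) x = y} =
        ⋃ z, {g : Equiv.Perm Ω | g z = y} ×ˢ {g : Equiv.Perm Ω | g x = z} := by
      ext p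
      simp
    rw [this]
    exact isOpen_iUnion fun z => (isOpen_perm_apply_eq z y).prod (isOpen_perm_apply_eq x z)
  continuous_inv := continuous_perm_iff.2 fun x y => by
    have : {g : Equiv.Perm Ω | g⁻¹ x = y} = {g : Equiv.Perm Ω | g y = x} := by
      ext g
      exact Equiv.Perm.inv_eq_iff_eq.trans eq_comm
    rw [this]
    exact isOpen_perm_apply_eq y x

variable {Ω : Type*} {G : Subgroup (Equiv.Perm Ω)}

theorem isOpen_stabilizer (G : Subgroup (Equiv.Perm Ω)) (x : Ω) :
    IsOpen {g : G | g • x = x} :=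
  (isOpen_perm_apply_eq x x).preimage continuous_subtype_val

theorem IsSubdegreeFinite.hasFiniteSuborbits (h : IsSubdegreeFinite G) :
    HasFiniteSuborbits G Ω := by
  intro x y z
  by_cases h0 : ∃ g₀ : G, g₀ • x = z
  · obtain ⟨g₀, rfl⟩ := h0
    refine (h (g₀ • x) (g₀ • y)).subset ?_
    rintro _ ⟨g, hg, rfl⟩
    refine ⟨⟨g * g₀⁻¹, ?_⟩, ?_⟩
    · rw [MulAction.mem_stabilizer_iff, mul_smul, inv_smul_smul, hg]
    · show (g * g₀⁻¹) • g₀ • y = g • y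
      rw [mul_smul, inv_smul_smul]
  · refine Set.finite_empty.subset ?_
    rintro _ ⟨g, hg, -⟩
    exact h0 ⟨g, hg⟩

/-- Along an ultrafilter, the image of each point takes one of finitely many values, hence
stabilises, which gives a pointwise limit lying in the closed group G. -/
theorem isCompact_of_isClosed_of_hasFiniteSuborbits (hG : IsClosed (G : Set (Equiv.Perm Ω)))
    (hfin : HasFiniteSuborbits G Ω) (x y : Ω) : IsCompact {g : G | g • x = y} := by
  rw [isCompact_iff_ultrafilter_le_nhds]
  intro f hf
  rw [Filter.le_principal_iff] at hf
  have hσ : ∀ z : Ω, ∃ w : Ω, {g : G | g • z = w} ∈ f := by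
    intro z
    have : ⋃ w ∈ {w | ∃ g : G, g • x = y ∧ g • z = w}, {g : G | g • z = w} ∈ f :=
      Filter.mem_of_superset hf fun g hg => Set.mem_biUnion ⟨g, hg, rfl⟩ rfl
    obtain ⟨w, -, hw⟩ := (Ultrafilter.finite_biUnion_mem_iff (hfin x z y)).1 this
    exact ⟨w, hw⟩
  -- A pointwise limit of permutations need not be surjective, so preimages have to stabilise too.
  have hτ : ∀ z : Ω, ∃ w : Ω, {g : G | g • w = z} ∈ f := by
    intro z
    have : ⋃ w ∈ {w | ∃ g : G, g • y = x ∧ g • z = w}, {g : G | g • w = z} ∈ f :=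
      Filter.mem_of_superset hf fun g hg =>
        Set.mem_biUnion (x := g⁻¹ • z) ⟨g⁻¹, inv_smul_eq_iff.2 (Eq.symm hg), rfl⟩
          (smul_inv_smul g z)
    obtain ⟨w, -, hw⟩ := (Ultrafilter.finite_biUnion_mem_iff (hfin y z x)).1 this
    exact ⟨w, hw⟩
  choose σ hσ using hσ
  choose τ hτ using hτ
  let π : Equiv.Perm Ω :=
    { toFun := σ
      invFun := τ
      left_inv := fun z => by
        obtain ⟨g, h1, h2⟩ := f.nonempty_of_mem (Filter.inter_mem (hσ z) (hτ (σ z)))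
        exact smul_left_cancel g (Eq.trans h2 (Eq.symm h1))
      right_inv := fun z => by
        obtain ⟨g, h1, h2⟩ := f.nonempty_of_mem (Filter.inter_mem (hσ (τ z)) (hτ z))
        exact Eq.trans (Eq.symm h1) h2 }
  have hlim : Filter.Tendsto (fun g : G => (g : Equiv.Perm Ω)) f (nhds π) := by
    let _ : TopologicalSpace Ω := ⊥
    have _ : DiscreteTopology Ω := ⟨rfl⟩
    have h : nhds π = Filter.comap (fun g : Equiv.Perm Ω => (g : Ω → Ω)) (nhds (π : Ω → Ω)) :=
      nhds_induced _ _
    rw [h, Filter.tendsto_comap_iff, tendsto_pi_nhds]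
    intro z
    rw [nhds_discrete, Filter.tendsto_pure]
    exact hσ z
  have hπ : π ∈ G := hG.mem_of_tendsto hlim (Filter.Eventually.of_forall fun g => g.2)
  refine ⟨⟨π, hπ⟩, ?_, ?_⟩
  · obtain ⟨g, h1, h2⟩ := f.nonempty_of_mem (Filter.inter_mem (hσ x) hf)
    exact Eq.trans (Eq.symm h1) h2
  · rw [nhds_subtype, ← Filter.tendsto_iff_comap]
    exact hlim

theorem isInvariantGraph_iSup_orbitalGraph (hfin : HasFiniteSuborbits G Ω)
    (S : Finset (Ω × Ω)) (hS : (⨆ p ∈ S, orbitalGraph G p.1 p.2).Connected) :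
    IsInvariantGraph G (⨆ p ∈ S, orbitalGraph G p.1 p.2) where
  connected := hS
  locallyFinite x := by
    have h : (⋃ p ∈ S, {w | ∃ g : G, g • p.1 = x ∧ g • p.2 = w} ∪
        {w | ∃ g : G, g • p.2 = x ∧ g • p.1 = w}).Finite :=
      S.finite_toSet.biUnion fun p _ => (hfin _ _ _).union (hfin _ _ _)
    refine h.subset fun y hy => ?_
    simp only [SimpleGraph.mem_neighborSet, SimpleGraph.iSup_adj] at hy
    obtain ⟨p, hp, -, g, hg⟩ := hy
    refine Set.mem_biUnion hp ?_
    rcases Sym2.eq_iff.1 hg with ⟨h1, h2⟩ | ⟨h1, h2⟩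
    · exact Or.inl ⟨g, h1.symm, h2.symm⟩
    · exact Or.inr ⟨g, h1.symm, h2.symm⟩
  adj_smul k x y hxy := by
    simp only [SimpleGraph.iSup_adj] at hxy ⊢
    obtain ⟨p, hp, hne, g, hg⟩ := hxy
    refine ⟨p, hp, fun h => hne (smul_left_cancel k h), k * g, ?_⟩
    rw [mul_smul, mul_smul]
    exact congrArg (Sym2.map (k • ·)) hg

end PermutationTopology

/-! ### From ends to cuts, from primitivity to transitivity, and the conclusion. -/

/-- A locally finite graph with two ends is separated by a finite set of edges into two infinite
parts. -/
theorem exists_cut_of_end_nontrivial {Ω : Type*} {Γ : SimpleGraph Ω}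
    (hlf : ∀ x, (Γ.neighborSet x).Finite) (h : Γ.end.Nontrivial) :
    ∃ A, IsCut Γ A ∧ A.Infinite ∧ Aᶜ.Infinite := by
  obtain ⟨s, hs, t, ht, hst⟩ := h
  obtain ⟨K, hK⟩ := Function.ne_iff.1 hst
  -- The component chosen by an end is hit by the components it chooses beyond every larger finite
  -- set, so it is infinite.
  have hinf : ∀ s ∈ Γ.end, (s K).supp.Infinite := fun s hs =>
    (SimpleGraph.ComponentCompl.infinite_iff_in_all_ranges (s K)).2 fun L hL =>
      ⟨s (Opposite.op L), hs (CategoryTheory.opHomOfLE hL)⟩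
  refine ⟨(s K).supp, ?_, hinf s hs, (hinf t ht).mono ?_⟩
  · have hfin : ((K.unop : Set Ω) ∪ ⋃ k ∈ (K.unop : Set Ω), Γ.neighborSet k).Finite :=
      K.unop.finite_toSet.union (K.unop.finite_toSet.biUnion fun k _ => hlf k)
    refine hfin.subset ?_
    rintro v ⟨w, hvw, hne⟩
    by_cases hv : v ∈ (K.unop : Set Ω)
    · exact Or.inl hv
    by_cases hw : w ∈ (K.unop : Set Ω)
    · exact Or.inr (Set.mem_biUnion hw hvw.symm)
    · exact absurd ⟨fun h => SimpleGraph.ComponentCompl.mem_of_adj v w h hw hvw,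
        fun h => SimpleGraph.ComponentCompl.mem_of_adj w v h hv hvw.symm⟩ hne
  · exact Set.subset_compl_iff_disjoint_right.2
      (SimpleGraph.ComponentCompl.pairwise_disjoint (Ne.symm hK))

theorem isTransOn_of_isPreprimitive {G Ω : Type*} [Group G] [MulAction G Ω] [FaithfulSMul G Ω]
    [MulAction.IsPreprimitive G Ω] {N : Subgroup G} (hN : N.Normal) (hne : N ≠ ⊥) :
    IsTransOn N Ω := by
  have h : MulAction.fixedPoints N Ω ≠ .univ := fun h => hne <|
    (Subgroup.eq_bot_iff_forall _).2 fun n hn => FaithfulSMul.eq_of_smul_eq_smul (α := Ω)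
      fun x => by
        have hx : x ∈ MulAction.fixedPoints N Ω := h ▸ Set.mem_univ x
        rw [one_smul]
        exact hx ⟨n, hn⟩
  have := MulAction.IsQuasiPreprimitive.isPretransitive_of_normal h
  intro x y
  obtain ⟨n, hn⟩ := MulAction.exists_smul_eq N x y
  exact ⟨n, n.2, hn⟩

/-- The conclusion for an abstract topological group acting with compact open point
stabilisers. -/
theorem IsInvariantGraph.isAlmostTopologicallySimpleOver_closedMonolith {G Ω : Type*} [Group G]
    [TopologicalSpace G] [IsTopologicalGroup G] [MulAction G Ω] [FaithfulSMul G Ω]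
    [MulAction.IsPreprimitive G Ω] {Γ : SimpleGraph Ω}
    (hopen : ∀ x : Ω, IsOpen {g : G | g • x = x})
    (hcpt : ∀ x y : Ω, IsCompact {g : G | g • x = y}) (hΓ : IsInvariantGraph G Γ)
    (hfin : HasFiniteSuborbits G Ω) {A₀ : Set Ω} (hA₀ : IsCut Γ A₀) (hinf : A₀.Infinite)
    (hinf' : A₀ᶜ.Infinite) :
    closedMonolith G ≠ ⊥ ∧ IsAlmostTopologicallySimpleOver (closedMonolith G) := by
  have : Infinite Ω := Set.infinite_univ_iff.1 (hinf.mono (Set.subset_univ _))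
  have hprim : ∀ N : Subgroup G, N.Normal → N ≠ ⊥ → IsTransOn N Ω :=
    fun N hN hne => isTransOn_of_isPreprimitive hN hne
  have hne : closedMonolith G ≠ ⊥ := closedMonolith_ne_bot hcpt
    (fun x y => (MulAction.exists_smul_eq G x y).imp fun g hg => ⟨trivial, hg⟩)
    (fun _ _ h₁ h₂ => hΓ.inf_ne_bot hfin hprim h₁ h₂) hprim
  have hnorm : (closedMonolith G).Normal := closedMonolith_normal
  have hmin : ∀ N : Subgroup G, N.Normal → N ≠ ⊥ → IsClosed (N : Set G) → closedMonolith G ≤ N :=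
    fun N => closedMonolith_le
  have hab : ¬ ∀ a ∈ closedMonolith G, ∀ b ∈ closedMonolith G, a * b = b * a :=
    fun h => hne (hΓ.eq_bot_of_abelian hprim hnorm h)
  have hcomm : ∀ M₁ M₂ : Subgroup G, M₁ ≠ ⊥ → M₂ ≠ ⊥ →
      (∀ b ∈ closedMonolith G, ∀ m ∈ M₁, b * m * b⁻¹ ∈ M₁) →
      (∀ b ∈ closedMonolith G, ∀ m ∈ M₂, b * m * b⁻¹ ∈ M₂) →
      ¬ ∀ a ∈ M₁, ∀ b ∈ M₂, a * b = b * a := fun M₁ M₂ h₁ h₂ hn₁ hn₂ hc =>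
    hΓ.false_of_commuting hopen hfin (hprim _ hnorm hne)
      (isOpenlyPerfect_of_minimal hopen hnorm hmin hab) hmin hA₀ hinf hinf' h₁ h₂ hn₁ hn₂ hc
  refine ⟨hne, hnorm, isClosed_closedMonolith, ?_, ⟨?_, ?_⟩, ?_⟩
  · by_contra hcon
    push Not at hcon
    exact hab fun a ha b hb => congrArg Subtype.val (hcon ⟨a, ha⟩ ⟨b, hb⟩)
  · exact (Subgroup.nontrivial_iff_ne_bot _).2 hne
  · intro N hN hNc
    refine or_iff_not_imp_left.2 fun hNb => ?_
    have hle : closedMonolith G ≤ N.map (closedMonolith G).subtype := by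
      refine hΓ.le_of_normalised hopen hcpt hfin hprim hnorm hne hmin hcomm
        (Subgroup.map_subtype_le _) ?_ ?_ ?_
      · rw [Subgroup.coe_map]
        exact isClosed_closedMonolith.isClosedMap_subtype_val _ hNc
      · rwa [Ne, Subgroup.map_eq_bot_iff_of_injective _ (Subgroup.subtype_injective _)]
      · rintro b hb _ ⟨n, hn, rfl⟩
        exact ⟨⟨b, hb⟩ * n * ⟨b, hb⟩⁻¹, hN.conj_mem n hn _, rfl⟩
    refine eq_top_iff.2 fun b _ => ?_
    obtain ⟨n, hn, hnb⟩ := hle b.2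
    rwa [← Subtype.ext (a1 := n) (a2 := b) hnb]
  · rw [injective_iff_map_eq_one]
    intro g hg
    have hgc : g ∈ Subgroup.centralizer (closedMonolith G : Set G) := by
      refine Subgroup.mem_centralizer_iff.2 fun b hb => ?_
      have h := congrArg Subtype.val (DFunLike.congr_fun hg ⟨b, hb⟩)
      rw [MulAut.conjNormal_apply] at h
      exact (mul_inv_eq_iff_eq_mul.1 h).symm
    -- A nontrivial centralizer would meet the monolith nontrivially, in an abelian normal subgroup.
    have hz : Subgroup.centralizer (closedMonolith G : Set G) = ⊥ := by
      by_contra hcon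
      refine hΓ.inf_ne_bot hfin hprim hnorm inferInstance hne hcon ?_
      exact hΓ.eq_bot_of_abelian hprim inferInstance
        fun a ha b hb => Subgroup.mem_centralizer_iff.1 hb.2 a ha.1
    rwa [hz, Subgroup.mem_bot] at hgc

theorem mainTheorem10 {Ω : Type*} (G : Subgroup (Equiv.Perm Ω))
    (hclosed : IsClosed (G : Set (Equiv.Perm Ω)))
    (hsub : IsSubdegreeFinite G)
    (hprim : MulAction.IsPreprimitive G Ω)
    (hends : HasMoreThanOneEnd G) :
    IsAlmostTopologicallySimple G ∧
      ∃ B : Subgroup G, IsMinimalClosedNormal B ∧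
        (∀ C : Subgroup G, IsMinimalClosedNormal C → C = B) ∧
        IsAlmostTopologicallySimpleOver B := by
  obtain ⟨S, hconn, hend⟩ := hends
  have hfin := hsub.hasFiniteSuborbits
  have hΓ := isInvariantGraph_iSup_orbitalGraph hfin S hconn
  obtain ⟨A₀, hA₀, hinf, hinf'⟩ := exists_cut_of_end_nontrivial hΓ.locallyFinite hend
  obtain ⟨hne, hB⟩ := hΓ.isAlmostTopologicallySimpleOver_closedMonolith (isOpen_stabilizer G)
    (isCompact_of_isClosed_of_hasFiniteSuborbits hclosed hfin) hfin hA₀ hinf hinf'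
  have hmem : closedMonolith G ≠ ⊥ ∧ (closedMonolith G).Normal ∧
      IsClosed (closedMonolith G : Set G) := ⟨hne, hB.normal, hB.isClosed⟩
  refine ⟨⟨_, hB⟩, closedMonolith G, ⟨hmem, fun N hN _ => closedMonolith_le hN.2.1 hN.1 hN.2.2⟩,
    fun C hC => ?_, hB⟩
  exact le_antisymm (hC.2 hmem (closedMonolith_le hC.1.2.1 hC.1.1 hC.1.2.2))
    (closedMonolith_le hC.1.2.1 hC.1.1 hC.1.2.2)
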